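/- Fix a dimension $d\ge 2$ and $p\in(0,1)$. Color each point of $\mathbb{Z}^d$ black with probability $p$ and white with probability $1-p$, independently, and let $Z$ be the random set of black points. For $z\in\mathbb{Z}^d$ let $B_1(z)=\prod_{i=1}^d[z_i,z_i+1]$, let $\Phi$ be the interior of $\bigcup_{z\in Z}B_1(z)$, and for an integer $L>0$ let $W_L(0)=\prod_{i=1}^d[-\lfloor L/2\rfloor,\lceil L/2\rceil]$. Let $\mathcal{G}$ be the set of homotopy types (classes up to homotopy equivalence) of finite connected cubical complexes in $\mathbb{R}^d$, i.e. of finite sets of elementary cubes of dimensions $0,\dots,d$ of the integer grid that are closed under passing to faces and have connected non-empty union. This set is countable. For $\gamma\in\mathcal{G}$ let $a_{L,\gamma}$ be the number of connected components of $\Phi$ that are entirely contained in $W_L(0)$ and are homotopy equivalent to the complexes in $\gamma$, divided by the number of all connected components of $\Phi$ that are entirely contained in $W_L(0)$ (with $a_{L,\gamma}=0$ if there are none), and define the random measure $$\mu_L=\sum_{\gamma\in\mathcal{G}}a_{L,\gamma}\,\delta_\gamma$$ on $\mathcal{G}$. Then there is a deterministic probability measure $\mu$ on $\mathcal{G}$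 with support $\mathcal{G}$, that is, $\mu(\{\gamma\})>0$ for every $\gamma\in\mathcal{G}$, such that $\mu_L\to\mu$ in probability with respect to the total variation distance: for every $\varepsilon>0$, $$\lim_{L\to\infty}\mathbb{P}\Big\{\sup_{A\subseteq\mathcal{G}}|\mu_L(A)-\mu(A)|>\varepsilon\Big\}=0 .$$ -/

import Mathlib

open MeasureTheory ProbabilityTheory Filter Topology
open scoped ENNReal ContinuousMap

noncomputable section

namespace CubicalPercolation

/-- An elementary cube of the cubical grid in `ℝ^d`: the cube with lower corner `corner ∈ ℤ^d`
which has unit length in the directions belonging to `dirs` and is degenerate in the others. -/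
structure ElementaryCube (d : ℕ) where
  corner : Fin d → ℤ
  dirs : Finset (Fin d)

/-- The closed cube, as a subset of `ℝ^d`. -/
def ElementaryCube.toSet {d : ℕ} (Q : ElementaryCube d) : Set (Fin d → ℝ) :=
  Set.Icc (fun i => (Q.corner i : ℝ)) (fun i => (Q.corner i : ℝ) + if i ∈ Q.dirs then 1 else 0)

instance (d : ℕ) : Countable (ElementaryCube d) :=
  Function.Injective.countable (f := fun Q : ElementaryCube d => (Q.corner, Q.dirs)) (by
    rintro ⟨a, s⟩ ⟨b, t⟩ h
    simp only [Prod.mk.injEq] at h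
    rw [h.1, h.2])

/-- A finite connected cubical complex of the grid in `ℝ^d`: a finite set of elementary cubes,
closed under passing to faces, whose union is connected (and so non-empty). -/
structure CubicalComplex (d : ℕ) where
  cubes : Finset (ElementaryCube d)
  face_mem : ∀ Q ∈ cubes, ∀ R : ElementaryCube d, R.toSet ⊆ Q.toSet → R ∈ cubes
  connected : IsConnected (⋃ Q ∈ cubes, Q.toSet)

/-- The underlying space of a complex. -/
def CubicalComplex.space {d : ℕ} (K : CubicalComplex d) : Set (Fin d → ℝ) :=
  ⋃ Q ∈ K.cubes, Q.toSet

instance (d : ℕ) : Countable (CubicalComplex d) :=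
  Function.Injective.countable (f := fun K : CubicalComplex d => K.cubes) (by
    rintro ⟨a, _, _⟩ ⟨b, _, _⟩ h
    simpa using h)

/-- Homotopy equivalence of finite connected cubical complexes. -/
instance homotopySetoid (d : ℕ) : Setoid (CubicalComplex d) where
  r K K' := Nonempty (K.space ≃ₕ K'.space)
  iseqv :=
    ⟨fun _ => ⟨ContinuousMap.HomotopyEquiv.refl _⟩, fun ⟨h⟩ => ⟨h.symm⟩,
      fun ⟨h⟩ ⟨h'⟩ => ⟨h.trans h'⟩⟩

/-- The set `𝒢` of homotopy types of finite connected cubical complexes in `ℝ^d`. -/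
def HomotopyType (d : ℕ) : Type := Quotient (homotopySetoid d)

/-- There are only countably many homotopy types. -/
instance (d : ℕ) : Countable (HomotopyType d) :=
  inferInstanceAs (Countable (Quotient (homotopySetoid d)))

/-- Every set of homotopy types is measurable. -/
instance (d : ℕ) : MeasurableSpace (HomotopyType d) := ⊤

/-- `HasType s γ` says that the homotopy type `[s]` of the subset `s` of `ℝ^d` is `γ`: the class
`γ` consists of complexes that are homotopy equivalent to `s`. -/
def HasType {d : ℕ} (s : Set (Fin d → ℝ)) (γ : HomotopyType d) : Prop :=
  ∃ K : CubicalComplex d, Quotient.mk (homotopySetoid d) K = γ ∧ Nonempty (s ≃ₕ K.space)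

/-- The closed unit cube `B_1(z)` with lower corner `z ∈ ℤ^d`. -/
def unitCube {d : ℕ} (z : Fin d → ℤ) : Set (Fin d → ℝ) :=
  Set.Icc (fun i => (z i : ℝ)) (fun i => (z i : ℝ) + 1)

/-- The interior `Φ` of the union of the black cubes, where `Z` is the set of black points. -/
def blackRegion {d : ℕ} (Z : Set (Fin d → ℤ)) : Set (Fin d → ℝ) :=
  interior (⋃ z ∈ Z, unitCube z)

/-- The window `W_L(x)` of side length `L`. -/
def window {d : ℕ} (L : ℕ) (x : Fin d → ℤ) : Set (Fin d → ℝ) :=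
  Set.Icc (fun i => (x i : ℝ) - (⌊(L : ℝ) / 2⌋ : ℝ)) (fun i => (x i : ℝ) + (⌈(L : ℝ) / 2⌉ : ℝ))

/-- The connected components of `Y` that are entirely contained in `W`. -/
def componentsIn {d : ℕ} (Y W : Set (Fin d → ℝ)) : Set (Set (Fin d → ℝ)) :=
  {s | (∃ x ∈ Y, s = connectedComponentIn Y x) ∧ s ⊆ W}

/-- The random homotopy measure `μ_L = ∑_γ a_{L,γ} δ_γ` for the set `Z` of black points. Here
`a_{L,γ}` is the number of components of `Φ` inside `W_L(0)` with homotopy type `γ`, divided by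
the number of all components of `Φ` inside `W_L(0)`. It is zero if there are no such components. -/
def homotopyMeasure {d : ℕ} (L : ℕ) (Z : Set (Fin d → ℤ)) : Measure (HomotopyType d) :=
  Measure.sum fun γ =>
    (({s ∈ componentsIn (blackRegion Z) (window L 0) | HasType s γ}.ncard : ℝ≥0∞) /
      ((componentsIn (blackRegion Z) (window L 0)).ncard : ℝ≥0∞)) • Measure.dirac γ

/-- The total variation distance `sup_A |μ(A) - ν(A)|` of two finite measures. -/
def tvDist {α : Type*} [MeasurableSpace α] (μ ν : Measure α) : ℝ :=
  ⨆ A : {A : Set α // MeasurableSet A}, |μ.real A.1 - ν.real A.1|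

/-- Bernoulli site percolation on `ℤ^d` with parameter `p`: each point of `ℤ^d` belongs to the
random set `Z` with probability `p`, independently of the others. -/
structure IsBernoulliPercolation {Ω : Type*} [MeasurableSpace Ω] (P : Measure Ω) {d : ℕ} (p : ℝ)
    (Z : Ω → Set (Fin d → ℤ)) : Prop where
  measurableSet_mem : ∀ x, MeasurableSet {ω | x ∈ Z ω}
  indep : iIndepSet (fun x => {ω | x ∈ Z ω}) P
  prob_mem : ∀ x, P {ω | x ∈ Z ω} = ENNReal.ofReal p

end CubicalPercolation

end

/-!
Components of the black region are matched with finite sets of sites. For `D ⊆ ℤ^d` the interior of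
the union of the cubes of `D` consists of the points all of whose surrounding cubes belong to `D`
(`openRegion`). A point of the black region can be joined inside it to the center of every cube
around it, so each component inside the window is `openRegion D` for a unique finite `D`, a
*cluster* (`componentsIn_blackRegion`). Being a cluster depends only on the colors of the sites in
or next to `D`.

Topologically, `openRegion D` is homotopy equivalent to the full cubical complex with vertex set `D`
(`nonempty_homotopyEquiv_fullRegion`): shift centers of cubes to integer points and squeeze every
coordinate towards the nearest half-integer, leaving a zone around each integer whose width is the
distance to the complement of `openRegion D`. So every finite cluster has a homotopy type.
Conversely, if `K` is a finite connected complex and `D` is the set of integer points of `2|K|`, the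
full complex on `D` is exactly `2|K|` (`mem_fullRegion_doubledSites`), so every homotopy type is the
type of some cluster (`exists_shape_type`).

Every finite cluster is a translate of exactly one shape, an animal with lexicographically smallest
site `0` (`bijective_translate`). By independence and finite range of dependence, the number of
clusters of a fixed shape `C` in the window, divided by `L^d`, converges in mean to the probability
`density q C > 0` that `C` is a cluster (`IsBernoulliPercolation.tendsto_deviation`). Its
expectation is at most this density, and the densities are summable since the site `0` lies in at
most one cluster. By dominated convergence, the `ℓ¹` distance between the counts per site of all
shapes and the densities tends to `0` in mean (`IsBernoulliPercolation.tendsto_tsum_deviation`). The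
limit `μ` is the distribution of the homotopy type of a shape with the densities, normalized, as
weights. The total variation distance is bounded by a multiple of the `ℓ¹` distance
(`tvDist_typeMeasure_le`), and Markov's inequality gives convergence in probability.
-/

namespace CubicalPercolation

variable {d : ℕ}

/-! ### The open region carried by a set of cubes -/

/-- The points of `ℝ^d` all of whose surrounding unit cubes have their lower corner in `D`. This is
the interior of the union of the cubes of `D`, see `interior_iUnion_unitCube`. -/
def openRegion (D : Set (Fin d → ℤ)) : Set (Fin d → ℝ) :=
  {x | ∀ z, x ∈ unitCube z → z ∈ D}

theorem mem_unitCube {z : Fin d → ℤ} {x : Fin d → ℝ} :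
    x ∈ unitCube z ↔ ∀ i, (z i : ℝ) ≤ x i ∧ x i ≤ z i + 1 := by
  simp only [unitCube, Set.mem_Icc, Pi.le_def]
  exact forall_and.symm

/-- The center of the unit cube with lower corner `z`. -/
noncomputable def cubeCenter (z : Fin d → ℤ) : Fin d → ℝ := fun i => z i + 1 / 2

theorem cubeCenter_mem (z : Fin d → ℤ) : cubeCenter z ∈ unitCube z :=
  mem_unitCube.2 fun _ => by constructor <;> simp only [cubeCenter] <;> linarith

theorem mem_unitCube_floor (x : Fin d → ℝ) : x ∈ unitCube (fun i => ⌊x i⌋) :=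
  mem_unitCube.2 fun _ => ⟨Int.floor_le _, (Int.lt_floor_add_one _).le⟩

/-- A point in the interior of a unit cube lies in no other unit cube. -/
theorem eq_of_mem_unitCube {z w : Fin d → ℤ} {x : Fin d → ℝ}
    (hz : ∀ i, (z i : ℝ) < x i ∧ x i < z i + 1) (hw : x ∈ unitCube w) : w = z := by
  ext i
  have h1 := hz i
  have h2 := mem_unitCube.1 hw i
  have h3 : ((w i : ℤ) : ℝ) < ((z i + 1 : ℤ) : ℝ) := by push_cast; linarith
  have h4 : ((z i : ℤ) : ℝ) < ((w i + 1 : ℤ) : ℝ) := by push_cast; linarith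
  have h5 := Int.cast_lt.1 h3
  have h6 := Int.cast_lt.1 h4
  omega

theorem mem_openRegion_of_interior {D : Set (Fin d → ℤ)} {z : Fin d → ℤ} {x : Fin d → ℝ}
    (hz : ∀ i, (z i : ℝ) < x i ∧ x i < z i + 1) (hD : z ∈ D) : x ∈ openRegion D :=
  fun _ hw => eq_of_mem_unitCube hz hw ▸ hD

theorem cubeCenter_mem_openRegion {D : Set (Fin d → ℤ)} {z : Fin d → ℤ} :
    cubeCenter z ∈ openRegion D ↔ z ∈ D :=
  ⟨fun h => h z (cubeCenter_mem z), fun h => mem_openRegion_of_interior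
    (fun _ => by constructor <;> simp only [cubeCenter] <;> linarith) h⟩

theorem openRegion_injective : Function.Injective (openRegion (d := d)) := fun D E h => by
  ext z
  rw [← cubeCenter_mem_openRegion, h, cubeCenter_mem_openRegion]

theorem openRegion_mono {D E : Set (Fin d → ℤ)} (h : D ⊆ E) : openRegion D ⊆ openRegion E :=
  fun _ hx z hz => h (hx z hz)

theorem openRegion_subset_iUnion (D : Set (Fin d → ℤ)) :
    openRegion D ⊆ ⋃ z ∈ D, unitCube z := fun x hx =>
  Set.mem_biUnion (hx _ (mem_unitCube_floor x)) (mem_unitCube_floor x)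

theorem isOpen_openRegion (D : Set (Fin d → ℤ)) : IsOpen (openRegion D) := by
  rw [isOpen_iff_mem_nhds]
  intro x hx
  have : ∀ᶠ y in 𝓝 x, ∀ i, (⌈x i⌉ : ℝ) - 1 < y i ∧ y i < (⌊x i⌋ : ℝ) + 1 := by
    rw [eventually_all]
    intro i
    have hc : Tendsto (fun y : Fin d → ℝ => y i) (𝓝 x) (𝓝 (x i)) :=
      (continuous_apply i).tendsto x
    have h1 : (⌈x i⌉ : ℝ) - 1 < x i := by linarith [Int.ceil_lt_add_one (x i)]
    have h2 : x i < (⌊x i⌋ : ℝ) + 1 := Int.lt_floor_add_one _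
    exact (hc.eventually (lt_mem_nhds h1)).and (hc.eventually (gt_mem_nhds h2))
  filter_upwards [this] with y hy z hz
  refine hx z (mem_unitCube.2 fun i => ?_)
  have h1 := mem_unitCube.1 hz i
  have h2 := hy i
  have h3 : ((z i : ℤ) : ℝ) < ((⌊x i⌋ + 1 : ℤ) : ℝ) := by push_cast; linarith
  have h4 : ((⌈x i⌉ : ℤ) : ℝ) < ((z i + 2 : ℤ) : ℝ) := by push_cast; linarith
  have h5 : z i ≤ ⌊x i⌋ := Int.lt_add_one_iff.1 (Int.cast_lt.1 h3)
  have h6 : ⌈x i⌉ ≤ z i + 1 := by have := Int.cast_lt.1 h4; omega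
  refine ⟨Int.le_floor.1 h5, ?_⟩
  have := Int.ceil_le.1 h6
  push_cast at this
  exact this

/-- The points of the half-open segment from a point of a cube to its center lie in the interior of
the cube. -/
theorem lineMap_mem_interior {z : Fin d → ℤ} {x : Fin d → ℝ} (hx : x ∈ unitCube z) {t : ℝ}
    (h0 : 0 < t) (h1 : t ≤ 1) (i : Fin d) :
    (z i : ℝ) < AffineMap.lineMap x (cubeCenter z) t i ∧
      AffineMap.lineMap x (cubeCenter z) t i < z i + 1 := by
  have h2 := mem_unitCube.1 hx i
  simp only [AffineMap.lineMap_apply, vsub_eq_sub, vadd_eq_add, Pi.add_apply, Pi.smul_apply,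
    Pi.sub_apply, smul_eq_mul, cubeCenter]
  constructor <;> nlinarith

theorem interior_iUnion_unitCube (D : Set (Fin d → ℤ)) :
    interior (⋃ z ∈ D, unitCube z) = openRegion D := by
  refine Set.Subset.antisymm (fun x hx z hz => ?_)
    (interior_maximal (openRegion_subset_iUnion D) (isOpen_openRegion D))
  have hc : Tendsto (fun t : ℝ => AffineMap.lineMap x (cubeCenter z) t) (𝓝[>] 0) (𝓝 x) := by
    have : Continuous (fun t : ℝ => (AffineMap.lineMap x (cubeCenter z) t : Fin d → ℝ)) :=
      AffineMap.lineMap_continuous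
    have h := this.tendsto 0
    rw [AffineMap.lineMap_apply_zero] at h
    exact h.mono_left nhdsWithin_le_nhds
  have h1 := hc.eventually (mem_interior_iff_mem_nhds.1 hx)
  have h2 : ∀ᶠ t : ℝ in 𝓝[>] 0, t ∈ Set.Ioc (0 : ℝ) 1 := Ioc_mem_nhdsGT one_pos
  obtain ⟨t, ht, ht0, ht1⟩ := (h1.and h2).exists
  obtain ⟨w, hw, hw'⟩ := Set.mem_iUnion₂.1 ht
  exact eq_of_mem_unitCube (lineMap_mem_interior hz ht0 ht1) hw' ▸ hw

theorem blackRegion_eq (Z : Set (Fin d → ℤ)) : blackRegion Z = openRegion Z :=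
  interior_iUnion_unitCube Z

/-! ### Clusters and connected components -/

/-- `D` is a cluster of `Z`: the open region of `D` is connected, contained in the one of `Z`, and
relatively closed in it. The last two conditions involve only the sites next to `D`. -/
structure IsCluster (Z D : Set (Fin d → ℤ)) : Prop where
  isConnected : IsConnected (openRegion D)
  subset : D ⊆ Z
  closed : ∀ z ∈ D, ∀ x ∈ unitCube z, x ∈ openRegion Z → x ∈ openRegion D

theorem segment_subset_openRegion {Z : Set (Fin d → ℤ)} {z : Fin d → ℤ} {x : Fin d → ℝ}
    (hx : x ∈ openRegion Z) (hz : x ∈ unitCube z) :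
    segment ℝ x (cubeCenter z) ⊆ openRegion Z := by
  rw [segment_eq_image_lineMap]
  rintro _ ⟨t, ⟨h0, h1⟩, rfl⟩
  rcases h0.eq_or_lt with rfl | h0
  · simpa using hx
  · exact mem_openRegion_of_interior (lineMap_mem_interior hz h0 h1) (hx z hz)

theorem cubeCenter_mem_connectedComponentIn {Z : Set (Fin d → ℤ)} {z : Fin d → ℤ} {x : Fin d → ℝ}
    (hx : x ∈ openRegion Z) (hz : x ∈ unitCube z) :
    cubeCenter z ∈ connectedComponentIn (openRegion Z) x :=
  (convex_segment x (cubeCenter z)).isPreconnected.subset_connectedComponentIn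
    (left_mem_segment ℝ _ _) (segment_subset_openRegion hx hz) (right_mem_segment ℝ _ _)

theorem mem_connectedComponentIn_iff_cubeCenter {Z : Set (Fin d → ℤ)} {z : Fin d → ℤ}
    {x y : Fin d → ℝ} (hy : y ∈ openRegion Z) (hz : y ∈ unitCube z) :
    cubeCenter z ∈ connectedComponentIn (openRegion Z) x ↔
      y ∈ connectedComponentIn (openRegion Z) x := by
  have h := cubeCenter_mem_connectedComponentIn hy hz
  constructor
  · intro h'
    rw [connectedComponentIn_eq h', ← connectedComponentIn_eq h]
    exact mem_connectedComponentIn hy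
  · intro h'
    rwa [connectedComponentIn_eq h']

theorem isCompact_unitCube (z : Fin d → ℤ) : IsCompact (unitCube z) := isCompact_Icc

theorem IsCluster.connectedComponentIn_eq {Z D : Set (Fin d → ℤ)} (h : IsCluster Z D)
    (hD : D.Finite) {x : Fin d → ℝ} (hx : x ∈ openRegion D) :
    connectedComponentIn (openRegion Z) x = openRegion D := by
  have hxZ := openRegion_mono h.subset hx
  refine Set.Subset.antisymm ?_ (h.isConnected.isPreconnected.subset_connectedComponentIn hx
    (openRegion_mono h.subset))
  have hcl : IsClosed (⋃ z ∈ D, unitCube z) :=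
    hD.isClosed_biUnion fun z _ => (isCompact_unitCube z).isClosed
  refine isPreconnected_connectedComponentIn.subset_left_of_subset_union (isOpen_openRegion D)
    hcl.isOpen_compl ?_ ?_ ⟨x, mem_connectedComponentIn hxZ, hx⟩
  · exact Set.disjoint_compl_right_iff_subset.2 (openRegion_subset_iUnion D)
  · intro y hy
    by_cases hy' : y ∈ ⋃ z ∈ D, unitCube z
    · obtain ⟨z, hz, hyz⟩ := Set.mem_iUnion₂.1 hy'
      exact Or.inl (h.closed z hz y hyz (connectedComponentIn_subset _ _ hy))
    · exact Or.inr hy'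

theorem exists_isCluster {Z : Set (Fin d → ℤ)} {x : Fin d → ℝ} (hx : x ∈ openRegion Z) :
    ∃ D, IsCluster Z D ∧ connectedComponentIn (openRegion Z) x = openRegion D := by
  set s := connectedComponentIn (openRegion Z) x with hs
  have hsub : s ⊆ openRegion Z := connectedComponentIn_subset _ _
  have hDZ : {z | cubeCenter z ∈ s} ⊆ Z := fun z hz => cubeCenter_mem_openRegion.1 (hsub hz)
  have heq : s = openRegion {z | cubeCenter z ∈ s} := by
    ext y
    constructor
    · intro hy z hz
      exact (mem_connectedComponentIn_iff_cubeCenter (hsub hy) hz).2 hy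
    · intro hy
      exact (mem_connectedComponentIn_iff_cubeCenter (openRegion_mono hDZ hy)
        (mem_unitCube_floor y)).1 (hy _ (mem_unitCube_floor y))
  refine ⟨{z | cubeCenter z ∈ s}, ⟨?_, hDZ, ?_⟩, heq⟩
  · rw [← heq]
    exact ⟨⟨x, mem_connectedComponentIn hx⟩, isPreconnected_connectedComponentIn⟩
  · intro z hz y hy hyZ
    rw [← heq]
    exact (mem_connectedComponentIn_iff_cubeCenter hyZ hy).1 hz

/-- The sites whose cubes lie in the window of side length `L` around `0`. -/
noncomputable def boxSites (d L : ℕ) : Finset (Fin d → ℤ) :=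
  Finset.Icc (fun _ => -⌊(L : ℝ) / 2⌋) (fun _ => ⌈(L : ℝ) / 2⌉ - 1)

theorem mem_boxSites {L : ℕ} {z : Fin d → ℤ} :
    z ∈ boxSites d L ↔ ∀ i, -⌊(L : ℝ) / 2⌋ ≤ z i ∧ z i ≤ ⌈(L : ℝ) / 2⌉ - 1 := by
  simp only [boxSites, Finset.mem_Icc, Pi.le_def]
  exact forall_and.symm

theorem mem_window_zero {L : ℕ} {x : Fin d → ℝ} :
    x ∈ window L (0 : Fin d → ℤ) ↔
      ∀ i, -(⌊(L : ℝ) / 2⌋ : ℝ) ≤ x i ∧ x i ≤ (⌈(L : ℝ) / 2⌉ : ℝ) := by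
  simp only [window, Set.mem_Icc, Pi.le_def, Pi.zero_apply, Int.cast_zero, zero_sub, zero_add]
  exact forall_and.symm

theorem subset_boxSites_of_openRegion_subset {L : ℕ} {D : Set (Fin d → ℤ)}
    (h : openRegion D ⊆ window L 0) : D ⊆ boxSites d L := by
  intro z hz
  refine mem_boxSites.2 fun i => ?_
  have h1 := mem_window_zero.1 (h (cubeCenter_mem_openRegion.2 hz)) i
  simp only [cubeCenter] at h1
  have h2 : ((-⌊(L : ℝ) / 2⌋ : ℤ) : ℝ) < ((z i + 1 : ℤ) : ℝ) := by push_cast; linarith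
  have h3 : ((z i : ℤ) : ℝ) < ((⌈(L : ℝ) / 2⌉ : ℤ) : ℝ) := by linarith
  have h4 := Int.cast_lt.1 h2
  have h5 := Int.cast_lt.1 h3
  omega

theorem openRegion_subset_window {L : ℕ} {D : Set (Fin d → ℤ)} (h : D ⊆ boxSites d L) :
    openRegion D ⊆ window L 0 := by
  intro x hx
  obtain ⟨z, hz, hxz⟩ := Set.mem_iUnion₂.1 (openRegion_subset_iUnion D hx)
  refine mem_window_zero.2 fun i => ?_
  have h1 := mem_unitCube.1 hxz i
  have h2 := mem_boxSites.1 (h hz) i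
  have h3 : ((-⌊(L : ℝ) / 2⌋ : ℤ) : ℝ) ≤ z i := Int.cast_le.2 h2.1
  have h4 : (z i : ℝ) ≤ ((⌈(L : ℝ) / 2⌉ - 1 : ℤ) : ℝ) := Int.cast_le.2 h2.2
  push_cast at h3 h4
  constructor <;> linarith

/-- The components of the black region inside the window are the open regions of the clusters that
consist of sites of the window. -/
theorem componentsIn_blackRegion (Z : Set (Fin d → ℤ)) (L : ℕ) :
    componentsIn (blackRegion Z) (window L 0) =
      (fun D : Finset (Fin d → ℤ) => openRegion (D : Set (Fin d → ℤ))) ''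
        {D | IsCluster Z D ∧ D ⊆ boxSites d L} := by
  rw [blackRegion_eq]
  ext s
  constructor
  · rintro ⟨⟨x, hx, rfl⟩, hsW⟩
    obtain ⟨D, hD, hDeq⟩ := exists_isCluster hx
    rw [hDeq] at hsW ⊢
    have hsub := subset_boxSites_of_openRegion_subset hsW
    have hfin : D.Finite := (boxSites d L).finite_toSet.subset hsub
    refine ⟨hfin.toFinset, ⟨by simpa using hD, ?_⟩, by simp⟩
    rw [← Finset.coe_subset]
    simpa using hsub
  · rintro ⟨D, ⟨hD, hDL⟩, rfl⟩
    obtain ⟨x, hx⟩ := hD.isConnected.nonempty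
    exact ⟨⟨x, openRegion_mono hD.subset hx,
      (hD.connectedComponentIn_eq D.finite_toSet hx).symm⟩,
      openRegion_subset_window (Finset.coe_subset.2 hDL)⟩

/-! ### The open region of a finite set of sites is homotopy equivalent to a cubical complex -/

/-- The full cubical set on the vertex set `D`: the points of `ℝ^d` such that all vertices of the
smallest elementary cube around them belong to `D`. -/
def fullRegion (D : Set (Fin d → ℤ)) : Set (Fin d → ℝ) :=
  {y | ∀ z : Fin d → ℤ, (∀ i, |(z i : ℝ) - y i| < 1) → z ∈ D}

/-- For `0 < δ ≤ 1 / 2`, a continuous map of `[0, 1]` onto itself that fixes the end points and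
sends `[δ, 1 - δ]` to the midpoint. -/
noncomputable def squeeze (δ u : ℝ) : ℝ :=
  1 / 2 + min (u / (2 * δ)) (1 / 2) - min ((1 - u) / (2 * δ)) (1 / 2)

section squeeze

variable {δ u : ℝ}

theorem squeeze_apply_zero (h0 : 0 < δ) (h1 : δ ≤ 1 / 2) : squeeze δ 0 = 0 := by
  have h : (1 : ℝ) / 2 ≤ (1 - 0) / (2 * δ) := by
    rw [le_div_iff₀ (by linarith)]; linarith
  rw [squeeze, min_eq_right h, zero_div, min_eq_left (by norm_num)]; norm_num

theorem squeeze_apply_one (h0 : 0 < δ) (h1 : δ ≤ 1 / 2) : squeeze δ 1 = 1 := by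
  have h : (1 : ℝ) / 2 ≤ 1 / (2 * δ) := by
    rw [le_div_iff₀ (by linarith)]; linarith
  rw [squeeze, min_eq_right h, sub_self, zero_div, min_eq_left (by norm_num)]; norm_num

theorem squeeze_of_le (h0 : 0 < δ) (h1 : δ ≤ 1 / 2) (hu : u ≤ δ) : squeeze δ u = u / (2 * δ) := by
  have h : (1 : ℝ) / 2 ≤ (1 - u) / (2 * δ) := by
    rw [le_div_iff₀ (by linarith)]; linarith
  have h' : u / (2 * δ) ≤ 1 / 2 := by
    rw [div_le_iff₀ (by linarith)]; linarith
  rw [squeeze, min_eq_right h, min_eq_left h']; ring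

theorem squeeze_of_ge (h0 : 0 < δ) (h1 : δ ≤ 1 / 2) (hu : 1 - δ ≤ u) :
    squeeze δ u = 1 - (1 - u) / (2 * δ) := by
  have h : (1 : ℝ) / 2 ≤ u / (2 * δ) := by
    rw [le_div_iff₀ (by linarith)]; linarith
  have h' : (1 - u) / (2 * δ) ≤ 1 / 2 := by
    rw [div_le_iff₀ (by linarith)]; linarith
  rw [squeeze, min_eq_right h, min_eq_left h']; ring

theorem squeeze_of_mem (h0 : 0 < δ) (hu : δ ≤ u) (hu' : u ≤ 1 - δ) : squeeze δ u = 1 / 2 := by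
  have h : (1 : ℝ) / 2 ≤ u / (2 * δ) := by
    rw [le_div_iff₀ (by linarith)]; linarith
  have h' : (1 : ℝ) / 2 ≤ (1 - u) / (2 * δ) := by
    rw [le_div_iff₀ (by linarith)]; linarith
  rw [squeeze, min_eq_right h, min_eq_right h']; ring

theorem squeeze_mem_of_le_half (h0 : 0 < δ) (h1 : δ ≤ 1 / 2) (hu0 : 0 ≤ u) (hu : u ≤ 1 / 2) :
    0 ≤ squeeze δ u ∧ squeeze δ u ≤ 1 / 2 := by
  rcases le_total u δ with h | h
  · rw [squeeze_of_le h0 h1 h]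
    refine ⟨by positivity, ?_⟩
    rw [div_le_iff₀ (by linarith)]; linarith
  · rw [squeeze_of_mem h0 h (by linarith)]; norm_num

theorem squeeze_mem_of_half_le (h0 : 0 < δ) (h1 : δ ≤ 1 / 2) (hu : 1 / 2 ≤ u) (hu1 : u ≤ 1) :
    1 / 2 ≤ squeeze δ u ∧ squeeze δ u ≤ 1 := by
  rcases le_total (1 - δ) u with h | h
  · rw [squeeze_of_ge h0 h1 h]
    have h2 : (1 - u) / (2 * δ) ≤ 1 / 2 := by
      rw [div_le_iff₀ (by linarith)]; linarith
    have h3 : 0 ≤ (1 - u) / (2 * δ) := div_nonneg (by linarith) (by linarith)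
    constructor <;> linarith
  · rw [squeeze_of_mem h0 (by linarith) h]; norm_num

theorem squeeze_mem_Ioo (h0 : 0 < δ) (h1 : δ ≤ 1 / 2) (hu0 : 0 < u) (hu1 : u < 1) :
    0 < squeeze δ u ∧ squeeze δ u < 1 := by
  rcases le_total u δ with h | h
  · refine ⟨?_, by linarith [squeeze_mem_of_le_half h0 h1 hu0.le (by linarith)]⟩
    rw [squeeze_of_le h0 h1 h]; positivity
  rcases le_total (1 - δ) u with h' | h'
  · refine ⟨by linarith [squeeze_mem_of_half_le h0 h1 (by linarith) hu1.le], ?_⟩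
    rw [squeeze_of_ge h0 h1 h']
    have : 0 < (1 - u) / (2 * δ) := div_pos (by linarith) (by linarith)
    linarith
  · rw [squeeze_of_mem h0 h h']; norm_num

theorem continuousOn_squeeze :
    ContinuousOn (fun q : ℝ × ℝ => squeeze q.1 q.2) {q | 0 < q.1} := by
  unfold squeeze
  have h : ∀ q ∈ {q : ℝ × ℝ | 0 < q.1}, 2 * q.1 ≠ 0 := fun q hq => by
    have : 0 < q.1 := hq
    positivity
  refine ContinuousOn.sub (ContinuousOn.add continuousOn_const (ContinuousOn.inf
    (ContinuousOn.div (by fun_prop) (by fun_prop) h) continuousOn_const)) (ContinuousOn.inf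
    (ContinuousOn.div (by fun_prop) (by fun_prop) h) continuousOn_const)

/-- If the center of the unit interval `[z, z + 1]` is at distance less than `1` from the squeezed
point, then the interval contains a point at distance less than `δ` from the original point. -/
theorem exists_near_of_squeeze (h0 : 0 < δ) (h1 : δ ≤ 1 / 2) {t : ℝ} {z : ℤ}
    (hz : |(z : ℝ) - (⌊t⌋ + squeeze δ (Int.fract t) - 1 / 2)| < 1) :
    ∃ y : ℝ, |y - t| < δ ∧ (z : ℝ) ≤ y ∧ y ≤ z + 1 := by
  have ht := Int.floor_add_fract t
  have hu0 := Int.fract_nonneg t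
  have hu1 := Int.fract_lt_one t
  set n := ⌊t⌋
  set u := Int.fract t
  rw [abs_lt] at hz
  rcases lt_or_ge u δ with h | h
  · have h2 := squeeze_mem_of_le_half h0 h1 hu0 (by linarith)
    have h3 : squeeze δ u < 1 / 2 := by
      rw [squeeze_of_le h0 h1 h.le, div_lt_iff₀ (by linarith)]; linarith
    have h4 : ((n - 2 : ℤ) : ℝ) < z := by push_cast; linarith
    have h5 : (z : ℝ) < ((n + 1 : ℤ) : ℝ) := by push_cast; linarith
    have h6 := Int.cast_lt.1 h4
    have h7 := Int.cast_lt.1 h5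
    obtain h8 | h8 : z = n ∨ z = n - 1 := by omega
    · exact ⟨t, by simpa using h0, by rw [h8]; linarith, by rw [h8]; linarith⟩
    · refine ⟨n, by rw [abs_lt]; constructor <;> linarith, ?_, ?_⟩ <;> rw [h8] <;> push_cast <;>
        linarith
  rcases lt_or_ge (1 - δ) u with h' | h'
  · have h2 := squeeze_mem_of_half_le h0 h1 (by linarith) hu1.le
    have h3 : 1 / 2 < squeeze δ u := by
      have : (1 - u) / (2 * δ) < 1 / 2 := by rw [div_lt_iff₀ (by linarith)]; linarith
      rw [squeeze_of_ge h0 h1 h'.le]; linarith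
    have h4 : ((n - 1 : ℤ) : ℝ) < z := by push_cast; linarith
    have h5 : (z : ℝ) < ((n + 2 : ℤ) : ℝ) := by push_cast; linarith
    have h6 := Int.cast_lt.1 h4
    have h7 := Int.cast_lt.1 h5
    obtain h8 | h8 : z = n ∨ z = n + 1 := by omega
    · exact ⟨t, by simpa using h0, by rw [h8]; linarith, by rw [h8]; linarith⟩
    · refine ⟨n + 1, by rw [abs_lt]; constructor <;> linarith, ?_, ?_⟩ <;> rw [h8] <;> push_cast <;>
        linarith
  · rw [squeeze_of_mem h0 h h'] at hz
    have h4 : ((n - 1 : ℤ) : ℝ) < z := by push_cast; linarith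
    have h5 : (z : ℝ) < ((n + 1 : ℤ) : ℝ) := by push_cast; linarith
    have h6 := Int.cast_lt.1 h4
    have h7 := Int.cast_lt.1 h5
    have h8 : z = n := by omega
    exact ⟨t, by simpa using h0, by rw [h8]; linarith, by rw [h8]; linarith⟩

/-- Squeezing along a straight line meets no new unit intervals. -/
theorem mem_Icc_of_squeeze (h0 : 0 < δ) (h1 : δ ≤ 1 / 2) {t s : ℝ} {z : ℤ} (hs0 : 0 ≤ s)
    (hs1 : s ≤ 1)
    (hz : (z : ℝ) ≤ (1 - s) * t + s * (⌊t⌋ + squeeze δ (Int.fract t)) ∧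
      (1 - s) * t + s * (⌊t⌋ + squeeze δ (Int.fract t)) ≤ z + 1) : (z : ℝ) ≤ t ∧ t ≤ z + 1 := by
  have ht := Int.floor_add_fract t
  have hu0 := Int.fract_nonneg t
  have hu1 := Int.fract_lt_one t
  set n := ⌊t⌋
  set u := Int.fract t
  have hq : (1 - s) * t + s * (n + squeeze δ u) = n + ((1 - s) * u + s * squeeze δ u) := by
    rw [← ht]; ring
  rw [hq] at hz
  rcases hu0.eq_or_lt with h | h
  · rw [← h, squeeze_apply_zero h0 h1] at hz
    constructor <;> linarith
  · obtain ⟨h2, h3⟩ := squeeze_mem_Ioo h0 h1 h hu1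
    have h4 : 0 < (1 - s) * u + s * squeeze δ u := by
      rcases hs0.eq_or_lt with h' | h'
      · rw [← h']; simpa using h
      · have := mul_pos h' h2
        have := mul_nonneg (sub_nonneg.2 hs1) h.le
        linarith
    have h5 : (1 - s) * u + s * squeeze δ u < 1 := by
      rcases hs0.eq_or_lt with h' | h'
      · rw [← h']; simpa using hu1
      · have := mul_lt_mul_of_pos_left h3 h'
        have := mul_le_mul_of_nonneg_left hu1.le (sub_nonneg.2 hs1)
        linarith
    have h6 : (z : ℝ) < ((n + 1 : ℤ) : ℝ) := by push_cast; linarith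
    have h7 : (n : ℝ) < ((z + 1 : ℤ) : ℝ) := by push_cast; linarith
    have h8 := Int.cast_lt.1 h6
    have h9 := Int.cast_lt.1 h7
    have h10 : z = n := by omega
    rw [h10]
    constructor <;> linarith

/-- Squeezing along a straight line, shifted by `1 / 2`, meets no new integer intervals. -/
theorem abs_sub_lt_of_squeeze (h0 : 0 < δ) (h1 : δ ≤ 1 / 2) {t s : ℝ} {z : ℤ} (hs0 : 0 ≤ s)
    (hs1 : s ≤ 1)
    (hz : |(z : ℝ) - ((1 - s) * (t - 1 / 2) + s * (⌊t⌋ + squeeze δ (Int.fract t) - 1 / 2))| < 1) :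
    |(z : ℝ) - (t - 1 / 2)| < 1 := by
  have ht := Int.floor_add_fract t
  have hu0 := Int.fract_nonneg t
  have hu1 := Int.fract_lt_one t
  set n := ⌊t⌋
  set u := Int.fract t
  have hq : (1 - s) * (t - 1 / 2) + s * (n + squeeze δ u - 1 / 2) =
      n + ((1 - s) * u + s * squeeze δ u) - 1 / 2 := by
    rw [← ht]; ring
  rw [hq] at hz
  set q := (1 - s) * u + s * squeeze δ u with hqdef
  rw [abs_lt] at hz ⊢
  have hs1' : 0 ≤ 1 - s := sub_nonneg.2 hs1
  rcases lt_trichotomy u (1 / 2) with h | h | h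
  · have h2 := squeeze_mem_of_le_half h0 h1 hu0 h.le
    have hq0 : 0 ≤ q := add_nonneg (mul_nonneg hs1' hu0) (mul_nonneg hs0 h2.1)
    have hq1 : q ≤ 1 / 2 := by
      have := mul_le_mul_of_nonneg_left h.le hs1'
      have := mul_le_mul_of_nonneg_left h2.2 hs0
      linarith
    have h4 : ((n - 2 : ℤ) : ℝ) < z := by push_cast; linarith
    have h5 : (z : ℝ) < ((n + 1 : ℤ) : ℝ) := by push_cast; linarith
    have h6 := Int.cast_lt.1 h4
    have h7 := Int.cast_lt.1 h5
    obtain h8 | h8 : z = n ∨ z = n - 1 := by omega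
    all_goals rw [h8]; push_cast; constructor <;> linarith
  · have h2 : squeeze δ u = 1 / 2 := squeeze_of_mem h0 (by linarith) (by linarith)
    have : q = u := by rw [hqdef, h2, h]; ring
    rw [this] at hz
    constructor <;> linarith
  · have h2 := squeeze_mem_of_half_le h0 h1 h.le hu1.le
    have hq0 : 1 / 2 ≤ q := by
      have := mul_le_mul_of_nonneg_left h.le hs1'
      have := mul_le_mul_of_nonneg_left h2.1 hs0
      linarith
    have hq1 : q ≤ 1 := by
      have := mul_le_mul_of_nonneg_left hu1.le hs1'
      have := mul_le_mul_of_nonneg_left h2.2 hs0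
      linarith
    have h4 : ((n - 1 : ℤ) : ℝ) < z := by push_cast; linarith
    have h5 : (z : ℝ) < ((n + 2 : ℤ) : ℝ) := by push_cast; linarith
    have h6 := Int.cast_lt.1 h4
    have h7 := Int.cast_lt.1 h5
    obtain h8 | h8 : z = n ∨ z = n + 1 := by omega
    all_goals rw [h8]; push_cast; constructor <;> linarith

end squeeze

/-- The distance from `x` to the complement of `openRegion D`, cut off at `1 / 2`. As `infDist` to
the empty set is `0`, this is only useful if the complement is non-empty. -/
noncomputable def margin (D : Set (Fin d → ℤ)) (x : Fin d → ℝ) : ℝ :=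
  min (1 / 2) (Metric.infDist x (openRegion D)ᶜ)

theorem margin_le (D : Set (Fin d → ℤ)) (x : Fin d → ℝ) : margin D x ≤ 1 / 2 := min_le_left _ _

theorem continuous_margin (D : Set (Fin d → ℤ)) : Continuous (margin D) :=
  continuous_const.min (Metric.continuous_infDist_pt _)

theorem margin_pos {D : Set (Fin d → ℤ)} (hD : (openRegion D)ᶜ.Nonempty) {x : Fin d → ℝ}
    (hx : x ∈ openRegion D) : 0 < margin D x :=
  lt_min (by norm_num) (((isOpen_openRegion D).isClosed_compl.notMem_iff_infDist_pos hD).1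
    fun h => h hx)

theorem mem_openRegion_of_abs_sub_lt {D : Set (Fin d → ℤ)} (hD : (openRegion D)ᶜ.Nonempty)
    {x y : Fin d → ℝ} (hx : x ∈ openRegion D) (hy : ∀ i, |y i - x i| < margin D x) :
    y ∈ openRegion D := by
  by_contra h
  have h1 : dist y x < margin D x := (dist_pi_lt_iff (margin_pos hD hx)).2 hy
  have h2 := Metric.infDist_le_dist_of_mem (x := x) (s := (openRegion D)ᶜ) h
  rw [dist_comm] at h2
  exact absurd (h1.trans_le (min_le_right _ _)) (not_lt.2 h2)

/-- The coordinatewise squeezing of `openRegion D`, with the width of the unsqueezed part given by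
the margin, shifted by `1 / 2` so that centers of cubes become integer points. -/
noncomputable def retract (D : Set (Fin d → ℤ)) (x : Fin d → ℝ) : Fin d → ℝ :=
  fun i => ⌊x i⌋ + squeeze (margin D x) (Int.fract (x i)) - 1 / 2

theorem retract_mem {D : Set (Fin d → ℤ)} (hD : (openRegion D)ᶜ.Nonempty) {x : Fin d → ℝ}
    (hx : x ∈ openRegion D) : retract D x ∈ fullRegion D := by
  intro z hz
  choose y hy1 hy2 using fun i => exists_near_of_squeeze (margin_pos hD hx) (margin_le D x) (hz i)
  exact mem_openRegion_of_abs_sub_lt hD hx hy1 z (mem_unitCube.2 hy2)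

theorem continuous_retract {D : Set (Fin d → ℤ)} (hD : (openRegion D)ᶜ.Nonempty) :
    Continuous fun x : openRegion D => retract D x := by
  refine continuous_pi fun i => ?_
  -- the displacement vanishes at both ends of `[0, 1]`, so it is continuous across the integers
  have h1 : Continuous fun x : openRegion D =>
      squeeze (margin D x) (Int.fract (x.1 i)) - Int.fract (x.1 i) := by
    refine ContinuousOn.comp_fract (s := fun x : openRegion D => x.1 i)
      (f := fun (x : openRegion D) u => squeeze (margin D x) u - u) ?_ ?_ ?_
    · refine ContinuousOn.sub (continuousOn_squeeze.comp (f := fun q : openRegion D × ℝ =>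
        (margin D q.1, q.2)) ?_ fun q _ => margin_pos hD q.1.2) continuousOn_snd
      exact (((continuous_margin D).comp (continuous_subtype_val.comp continuous_fst)).prodMk
        continuous_snd).continuousOn
    · exact (continuous_apply i).comp continuous_subtype_val
    · intro x
      simp only [squeeze_apply_zero (margin_pos hD x.2) (margin_le D x),
        squeeze_apply_one (margin_pos hD x.2) (margin_le D x)]
      norm_num
  have h2 : Continuous fun x : openRegion D => x.1 i :=
    (continuous_apply i).comp continuous_subtype_val
  have h3 : (fun x : openRegion D => retract D x i) = fun x : openRegion D => x.1 i +
      (squeeze (margin D x) (Int.fract (x.1 i)) - Int.fract (x.1 i)) - 1 / 2 := by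
    ext x
    simp only [retract]
    linarith [Int.floor_add_fract (x.1 i)]
  rw [h3]
  exact (h2.add h1).sub continuous_const

theorem add_half_mem {D : Set (Fin d → ℤ)} {y : Fin d → ℝ} (hy : y ∈ fullRegion D) :
    (fun i => y i + 1 / 2) ∈ openRegion D := by
  refine fun z hz => hy z fun i => ?_
  have := mem_unitCube.1 hz i
  rw [abs_lt]
  constructor <;> linarith

/-- A straight line homotopy inside a subset of `ℝ^d`. -/
theorem homotopic_id_of_lineMap {s : Set (Fin d → ℝ)} (f : C(s, s))
    (h : ∀ x : s, ∀ t : ℝ, 0 ≤ t → t ≤ 1 → (fun i => (1 - t) * x.1 i + t * (f x).1 i) ∈ s) :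
    f.Homotopic (ContinuousMap.id s) := by
  refine ContinuousMap.Homotopic.symm ⟨⟨⟨fun q => ⟨fun i => (1 - (q.1 : ℝ)) * q.2.1 i +
    q.1 * (f q.2).1 i, h q.2 q.1 q.1.2.1 q.1.2.2⟩, ?_⟩, ?_, ?_⟩⟩
  · refine Continuous.subtype_mk (continuous_pi fun i => ?_) _
    have h1 : Continuous fun q : unitInterval × s => (q.1 : ℝ) :=
      continuous_subtype_val.comp continuous_fst
    have h2 : Continuous fun q : unitInterval × s => q.2.1 i :=
      (continuous_apply i).comp (continuous_subtype_val.comp continuous_snd)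
    have h3 : Continuous fun q : unitInterval × s => (f q.2).1 i :=
      (continuous_apply i).comp (continuous_subtype_val.comp (f.continuous.comp continuous_snd))
    exact ((continuous_const.sub h1).mul h2).add (h1.mul h3)
  · intro x
    ext i
    simp
  · intro x
    ext i
    simp

/-- The open region is homotopy equivalent to the full cubical set: the coordinatewise squeezing is
a homotopy inverse of the shift by `1 / 2`, by straight line homotopies that never enter a new
cube. -/
theorem nonempty_homotopyEquiv_fullRegion {D : Set (Fin d → ℤ)}
    (hD : (openRegion D)ᶜ.Nonempty) : Nonempty (openRegion D ≃ₕ fullRegion D) := by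
  refine ⟨⟨⟨fun x => ⟨retract D x, retract_mem hD x.2⟩,
    (continuous_retract hD).subtype_mk _⟩, ⟨fun y => ⟨fun i => y.1 i + 1 / 2,
    add_half_mem y.2⟩, Continuous.subtype_mk (continuous_pi fun i =>
    ((continuous_apply i).comp continuous_subtype_val).add continuous_const) _⟩, ?_, ?_⟩⟩
  · refine homotopic_id_of_lineMap _ fun x t ht0 ht1 z hz => x.2 z (mem_unitCube.2 fun i => ?_)
    have := mem_unitCube.1 hz i
    simp only [ContinuousMap.comp_apply, ContinuousMap.coe_mk, retract, sub_add_cancel] at this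
    exact mem_Icc_of_squeeze (margin_pos hD x.2) (margin_le D x) ht0 ht1 this
  · refine homotopic_id_of_lineMap _ fun y t ht0 ht1 z hz => y.2 z fun i => ?_
    have h1 := hz i
    simp only [ContinuousMap.comp_apply, ContinuousMap.coe_mk, retract] at h1
    have h2 := abs_sub_lt_of_squeeze (margin_pos hD (add_half_mem y.2)) (margin_le D _)
      (t := y.1 i + 1 / 2) (z := z i) ht0 ht1 (by rwa [add_sub_cancel_right])
    rwa [add_sub_cancel_right] at h2

/-! ### Full cubical complexes -/

theorem mem_toSet {Q : ElementaryCube d} {x : Fin d → ℝ} :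
    x ∈ Q.toSet ↔ ∀ i, (Q.corner i : ℝ) ≤ x i ∧ x i ≤ Q.corner i + if i ∈ Q.dirs then 1 else 0 := by
  simp only [ElementaryCube.toSet, Set.mem_Icc, Pi.le_def]
  exact forall_and.symm

/-- The elementary cube that contains `y` in its relative interior. -/
noncomputable def carrier (y : Fin d → ℝ) : ElementaryCube d :=
  ⟨fun i => ⌊y i⌋, Finset.univ.filter fun i => Int.fract (y i) ≠ 0⟩

theorem mem_carrier (y : Fin d → ℝ) : y ∈ (carrier y).toSet := by
  refine mem_toSet.2 fun i => ⟨Int.floor_le _, ?_⟩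
  have h1 := Int.floor_add_fract (y i)
  have h2 := Int.fract_lt_one (y i)
  by_cases h : Int.fract (y i) = 0
  · simp only [carrier, Finset.mem_filter, Finset.mem_univ, true_and, h, ne_eq, not_true_eq_false,
      if_false]
    linarith
  · simp only [carrier, Finset.mem_filter, Finset.mem_univ, true_and, h, ne_eq, not_false_eq_true,
      if_true]
    linarith

theorem abs_sub_lt_one_of_mem_carrier {y : Fin d → ℝ} {z : Fin d → ℤ}
    (hz : (fun i => (z i : ℝ)) ∈ (carrier y).toSet) (i : Fin d) : |(z i : ℝ) - y i| < 1 := by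
  have h := mem_toSet.1 hz i
  have h1 := Int.floor_add_fract (y i)
  have h2 := Int.fract_lt_one (y i)
  have h3 := Int.fract_nonneg (y i)
  rw [abs_lt]
  by_cases h0 : Int.fract (y i) = 0
  · simp only [carrier, Finset.mem_filter, Finset.mem_univ, true_and, h0, ne_eq,
      not_true_eq_false, if_false] at h
    constructor <;> linarith
  · have h3' := h3.lt_of_ne' h0
    simp only [carrier, Finset.mem_filter, Finset.mem_univ, true_and, h0, ne_eq, not_false_eq_true,
      if_true] at h
    constructor <;> linarith

/-- Every elementary cube around `y` contains the vertices of the smallest one. -/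
theorem mem_toSet_of_abs_sub_lt_one {Q : ElementaryCube d} {y : Fin d → ℝ} (hy : y ∈ Q.toSet)
    {z : Fin d → ℤ} (hz : ∀ i, |(z i : ℝ) - y i| < 1) : (fun i => (z i : ℝ)) ∈ Q.toSet := by
  refine mem_toSet.2 fun i => ?_
  have h := mem_toSet.1 hy i
  have h1 := abs_lt.1 (hz i)
  have h2 : ((Q.corner i - 1 : ℤ) : ℝ) < z i := by push_cast; linarith
  have h3 := Int.cast_lt.1 h2
  have h4 : Q.corner i ≤ z i := by omega
  refine ⟨Int.cast_le.2 h4, ?_⟩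
  by_cases hi : i ∈ Q.dirs
  · simp only [hi, if_true] at h ⊢
    have h5 : (z i : ℝ) < ((Q.corner i + 2 : ℤ) : ℝ) := by push_cast; linarith
    have h6 := Int.cast_lt.1 h5
    have h7 : z i ≤ Q.corner i + 1 := by omega
    exact_mod_cast h7
  · simp only [hi, if_false] at h ⊢
    have h5 : (z i : ℝ) < ((Q.corner i + 1 : ℤ) : ℝ) := by push_cast; linarith
    have h6 := Int.cast_lt.1 h5
    have h7 : z i ≤ Q.corner i := by omega
    rw [add_zero]
    exact_mod_cast h7

theorem mem_fullRegion_iff {D : Set (Fin d → ℤ)} {y : Fin d → ℝ} :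
    y ∈ fullRegion D ↔ ∃ Q : ElementaryCube d,
      (∀ z : Fin d → ℤ, (fun i => (z i : ℝ)) ∈ Q.toSet → z ∈ D) ∧ y ∈ Q.toSet :=
  ⟨fun h => ⟨carrier y, fun z hz => h z (abs_sub_lt_one_of_mem_carrier hz), mem_carrier y⟩,
    fun ⟨_, hQ, hy⟩ z hz => hQ z (mem_toSet_of_abs_sub_lt_one hy hz)⟩

theorem corner_mem_toSet (Q : ElementaryCube d) : (fun i => (Q.corner i : ℝ)) ∈ Q.toSet := by
  refine mem_toSet.2 fun i => ⟨le_rfl, ?_⟩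
  split_ifs <;> simp

theorem finite_setOf_vertices_mem (D : Finset (Fin d → ℤ)) :
    {Q : ElementaryCube d | ∀ z : Fin d → ℤ, (fun i => (z i : ℝ)) ∈ Q.toSet → z ∈ D}.Finite := by
  refine Set.Finite.subset (((D ×ˢ (Finset.univ : Finset (Finset (Fin d)))).finite_toSet).image
    fun q => ElementaryCube.mk q.1 q.2) fun Q hQ => ?_
  exact ⟨(Q.corner, Q.dirs), by simpa using hQ _ (corner_mem_toSet Q), rfl⟩

theorem iUnion_full (D : Finset (Fin d → ℤ)) :
    ⋃ Q ∈ (finite_setOf_vertices_mem D).toFinset, Q.toSet =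
      fullRegion (D : Set (Fin d → ℤ)) := by
  ext y
  simp [mem_fullRegion_iff]

/-- The full cubical complex with vertex set `D`. -/
noncomputable def fullComplex (D : Finset (Fin d → ℤ))
    (h : IsConnected (fullRegion (D : Set (Fin d → ℤ)))) : CubicalComplex d where
  cubes := (finite_setOf_vertices_mem D).toFinset
  face_mem := by
    simp only [Set.Finite.mem_toFinset, Set.mem_ofPred_eq]
    exact fun Q hQ R hR z hz => hQ z (hR hz)
  connected := by rwa [iUnion_full]

theorem space_fullComplex (D : Finset (Fin d → ℤ))
    (h : IsConnected (fullRegion (D : Set (Fin d → ℤ)))) :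
    (fullComplex D h).space = fullRegion (D : Set (Fin d → ℤ)) := iUnion_full D

/-- Homotopy equivalences preserve connectedness. -/
theorem preconnectedSpace_of_homotopyEquiv {X Y : Type*} [TopologicalSpace X] [TopologicalSpace Y]
    (e : X ≃ₕ Y) [PreconnectedSpace X] : PreconnectedSpace Y := by
  refine preconnectedSpace_of_forall_constant fun g hg a b => ?_
  obtain ⟨H⟩ := e.right_inv
  have h1 : ∀ y, g (e.toFun (e.invFun y)) = g y := fun y => by
    have h := (isPreconnected_univ (α := unitInterval)).constant
      (f := fun t => g (H (t, y)))
      (hg.comp (H.continuous.comp (Continuous.prodMk_left y))).continuousOn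
      (Set.mem_univ 0) (Set.mem_univ 1)
    simpa using h
  have h2 := (isPreconnected_univ (α := X)).constant (f := fun x => g (e.toFun x))
    (hg.comp e.toFun.continuous).continuousOn (Set.mem_univ (e.invFun a))
    (Set.mem_univ (e.invFun b))
  rw [← h1 a, ← h1 b]
  exact h2

theorem isConnected_of_homotopyEquiv {s t : Set (Fin d → ℝ)} (h : Nonempty (s ≃ₕ t))
    (hs : IsConnected s) : IsConnected t := by
  obtain ⟨e⟩ := h
  have := Subtype.preconnectedSpace hs.isPreconnected
  have h1 := preconnectedSpace_of_homotopyEquiv e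
  obtain ⟨x, hx⟩ := hs.nonempty
  exact ⟨⟨_, (e.toFun ⟨x, hx⟩).2⟩, isPreconnected_iff_preconnectedSpace.2 h1⟩

/-! ### Every homotopy type occurs -/

/-- The integer points of the complex `K`, scaled by the factor `2`. -/
def doubledSites (K : CubicalComplex d) : Set (Fin d → ℤ) :=
  {z | (fun i => (z i : ℝ) / 2) ∈ K.space}

theorem mem_space {K : CubicalComplex d} {x : Fin d → ℝ} :
    x ∈ K.space ↔ ∃ Q ∈ K.cubes, x ∈ Q.toSet := by simp [CubicalComplex.space]

theorem finite_doubledSites (K : CubicalComplex d) : (doubledSites K).Finite := by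
  have : doubledSites K ⊆ ⋃ Q ∈ K.cubes, Set.Icc (fun i => 2 * Q.corner i)
      (fun i => 2 * Q.corner i + 2) := by
    intro z hz
    obtain ⟨Q, hQ, hzQ⟩ := mem_space.1 hz
    refine Set.mem_biUnion hQ ?_
    have h := mem_toSet.1 hzQ
    refine ⟨fun i => ?_, fun i => ?_⟩
    · have : ((2 * Q.corner i : ℤ) : ℝ) ≤ z i := by push_cast; linarith [(h i).1]
      exact Int.cast_le.1 this
    · have h2 : (if i ∈ Q.dirs then (1 : ℝ) else 0) ≤ 1 := by split_ifs <;> norm_num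
      have : (z i : ℝ) ≤ ((2 * Q.corner i + 2 : ℤ) : ℝ) := by push_cast; linarith [(h i).2]
      exact Int.cast_le.1 this
  exact (K.cubes.finite_toSet.biUnion fun Q _ => Set.finite_Icc _ _).subset this

/-- The smallest elementary cube around a point of a complex belongs to the complex. -/
theorem carrier_mem_cubes {K : CubicalComplex d} {x : Fin d → ℝ} (hx : x ∈ K.space) :
    carrier x ∈ K.cubes := by
  obtain ⟨Q, hQ, hxQ⟩ := mem_space.1 hx
  refine K.face_mem Q hQ _ fun y hy => mem_toSet.2 fun i => ?_
  have h := mem_toSet.1 hxQ i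
  have h1 := mem_toSet.1 hy i
  have h3 := Int.floor_add_fract (x i)
  have h4 := Int.fract_nonneg (x i)
  have h2 : Q.corner i ≤ ⌊x i⌋ := Int.le_floor.2 h.1
  have h2' : (Q.corner i : ℝ) ≤ ⌊x i⌋ := Int.cast_le.2 h2
  refine ⟨h2'.trans h1.1, h1.2.trans ?_⟩
  by_cases h0 : Int.fract (x i) = 0
  · simp only [carrier, Finset.mem_filter, Finset.mem_univ, true_and, h0, ne_eq,
      not_true_eq_false, if_false]
    linarith
  · have h4' := h4.lt_of_ne' h0
    simp only [carrier, Finset.mem_filter, Finset.mem_univ, true_and, h0, ne_eq,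
      not_false_eq_true, if_true]
    by_cases hi : i ∈ Q.dirs
    · simp only [hi, if_true] at h ⊢
      have : (⌊x i⌋ : ℝ) < ((Q.corner i + 1 : ℤ) : ℝ) := by push_cast; linarith
      have := Int.cast_lt.1 this
      have : ⌊x i⌋ ≤ Q.corner i := by omega
      have : (⌊x i⌋ : ℝ) ≤ Q.corner i := Int.cast_le.2 this
      linarith
    · simp only [hi, if_false] at h
      linarith

/-- The full cubical set on the doubled sites is the complex itself, scaled by `2`: a cube of the
doubled grid has a vertex that is odd in all directions of the cube, and the smallest elementary
cube of the original grid around that vertex contains the whole cube. -/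
theorem mem_fullRegion_doubledSites {K : CubicalComplex d} {y : Fin d → ℝ} :
    y ∈ fullRegion (doubledSites K) ↔ (fun i => y i / 2) ∈ K.space := by
  constructor
  · intro hy
    -- the vertex with odd coordinates in the directions in which `y` is not an integer
    let z : Fin d → ℤ := fun i => if Int.fract (y i) = 0 then ⌊y i⌋ else
      2 * ⌊(⌊y i⌋ : ℝ) / 2⌋ + 1
    have hfl : ∀ i, 2 * ⌊(⌊y i⌋ : ℝ) / 2⌋ = ⌊y i⌋ ∨ 2 * ⌊(⌊y i⌋ : ℝ) / 2⌋ + 1 = ⌊y i⌋ := fun i => by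
      have h1 := Int.floor_le ((⌊y i⌋ : ℝ) / 2)
      have h2 := Int.lt_floor_add_one ((⌊y i⌋ : ℝ) / 2)
      have h3 : ((2 * ⌊(⌊y i⌋ : ℝ) / 2⌋ : ℤ) : ℝ) ≤ ⌊y i⌋ := by push_cast; linarith
      have h4 : (⌊y i⌋ : ℝ) < ((2 * ⌊(⌊y i⌋ : ℝ) / 2⌋ + 2 : ℤ) : ℝ) := by push_cast; linarith
      have h5 := Int.cast_le.1 h3
      have h6 := Int.cast_lt.1 h4
      omega
    have hz : z ∈ doubledSites K := hy z fun i => by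
      have h1 := Int.floor_add_fract (y i)
      have h2 := Int.fract_nonneg (y i)
      have h3 := Int.fract_lt_one (y i)
      by_cases h : Int.fract (y i) = 0
      · simp only [z, h, if_true]
        rw [abs_lt]; constructor <;> linarith
      · have h2' := h2.lt_of_ne' h
        simp only [z, h, if_false]
        rcases hfl i with h4 | h4
        · rw [h4]; push_cast
          rw [abs_lt]; constructor <;> linarith
        · rw [h4]
          rw [abs_lt]; constructor <;> linarith
    refine mem_space.2 ⟨_, carrier_mem_cubes hz, mem_toSet.2 fun i => ?_⟩
    have h1 := Int.floor_add_fract (y i)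
    have h2 := Int.fract_nonneg (y i)
    have h3 := Int.fract_lt_one (y i)
    have hc := mem_toSet.1 (mem_carrier fun i => (z i : ℝ) / 2) i
    by_cases h : Int.fract (y i) = 0
    · have hzi : (z i : ℝ) = y i := by simp only [z, h, if_true]; linarith
      rw [hzi] at hc
      exact hc
    · have hzi : (z i : ℝ) / 2 = (⌊(⌊y i⌋ : ℝ) / 2⌋ : ℝ) + 1 / 2 := by
        simp only [z, h, if_false]; push_cast; ring
      have hfloor : ⌊(z i : ℝ) / 2⌋ = ⌊(⌊y i⌋ : ℝ) / 2⌋ := by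
        rw [hzi, Int.floor_intCast_add]; norm_num
      have hfr : Int.fract ((z i : ℝ) / 2) ≠ 0 := by
        rw [hzi, Int.fract_intCast_add]; norm_num [Int.fract]
      simp only [carrier, Finset.mem_filter, Finset.mem_univ, true_and, hfr, ne_eq,
        not_false_eq_true, if_true, hfloor]
      rcases hfl i with h4 | h4
      · have h5 : (2 : ℝ) * (⌊(⌊y i⌋ : ℝ) / 2⌋ : ℝ) = ⌊y i⌋ := by exact_mod_cast h4
        constructor <;> linarith
      · have h5 : (2 : ℝ) * (⌊(⌊y i⌋ : ℝ) / 2⌋ : ℝ) + 1 = ⌊y i⌋ := by exact_mod_cast h4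
        constructor <;> linarith
  · intro hy z hz
    refine mem_space.2 ⟨_, carrier_mem_cubes hy, mem_toSet.2 fun i => ?_⟩
    have hc := mem_toSet.1 (mem_carrier fun i => y i / 2) i
    have h1 := abs_lt.1 (hz i)
    by_cases h : Int.fract (y i / 2) = 0
    · have h3 := Int.floor_add_fract (y i / 2)
      have h4 : y i = ((2 * ⌊y i / 2⌋ : ℤ) : ℝ) := by push_cast; linarith
      have h5 : ((2 * ⌊y i / 2⌋ - 1 : ℤ) : ℝ) < z i := by
        rw [Int.cast_sub, ← h4]; push_cast; linarith
      have h6 : (z i : ℝ) < ((2 * ⌊y i / 2⌋ + 1 : ℤ) : ℝ) := by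
        rw [Int.cast_add, ← h4]; push_cast; linarith
      have h7 := Int.cast_lt.1 h5
      have h8 := Int.cast_lt.1 h6
      have h9 : z i = 2 * ⌊y i / 2⌋ := by omega
      have h10 : (z i : ℝ) = y i := by rw [h9, ← h4]
      rw [h10]
      exact hc
    · have h3 := Int.floor_add_fract (y i / 2)
      have h2 := (Int.fract_nonneg (y i / 2)).lt_of_ne' h
      have h4 := Int.fract_lt_one (y i / 2)
      simp only [carrier, Finset.mem_filter, Finset.mem_univ, true_and, h, ne_eq,
        not_false_eq_true, if_true]
      have h5 : ((2 * ⌊y i / 2⌋ - 1 : ℤ) : ℝ) < z i := by push_cast; linarith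
      have h6 : (z i : ℝ) < ((2 * ⌊y i / 2⌋ + 3 : ℤ) : ℝ) := by push_cast; linarith
      have h7 := Int.cast_lt.1 h5
      have h8 := Int.cast_lt.1 h6
      have h9 : ((2 * ⌊y i / 2⌋ : ℤ) : ℝ) ≤ z i := Int.cast_le.2 (by omega)
      have h10 : (z i : ℝ) ≤ ((2 * ⌊y i / 2⌋ + 2 : ℤ) : ℝ) := Int.cast_le.2 (by omega)
      push_cast at h9 h10
      constructor <;> linarith

/-- The equivalence is the scaling homeomorphism `2|K| ≃ₜ |K|`. -/
theorem nonempty_homotopyEquiv_doubledSites (K : CubicalComplex d) :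
    Nonempty (fullRegion (doubledSites K) ≃ₕ K.space) := by
  refine ⟨Homeomorph.toHomotopyEquiv
    { toFun := fun y => ⟨fun i => y.1 i / 2, mem_fullRegion_doubledSites.1 y.2⟩
      invFun := fun x => ⟨fun i => 2 * x.1 i, mem_fullRegion_doubledSites.2 (by
        convert x.2 using 2 with i
        ring)⟩
      left_inv := fun y => by ext i; simp only; ring
      right_inv := fun x => by ext i; simp only; ring
      continuous_toFun := Continuous.subtype_mk (continuous_pi fun i =>
        ((continuous_apply i).comp continuous_subtype_val).div_const _) _
      continuous_invFun := Continuous.subtype_mk (by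
        refine continuous_pi fun i => ?_
        exact continuous_const.mul ((continuous_apply i).comp continuous_subtype_val)) _ }⟩

theorem compl_openRegion_nonempty (hd : d ≠ 0) (D : Finset (Fin d → ℤ)) :
    (openRegion (D : Set (Fin d → ℤ)))ᶜ.Nonempty := by
  have : Nonempty (Fin d) := Fin.pos_iff_nonempty.1 (Nat.pos_of_ne_zero hd)
  obtain ⟨z, hz⟩ := Infinite.exists_notMem_finset D
  exact ⟨cubeCenter z, fun h => hz (by simpa using cubeCenter_mem_openRegion.1 h)⟩

theorem isConnected_fullRegion (hd : d ≠ 0) {D : Finset (Fin d → ℤ)}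
    (h : IsConnected (openRegion (D : Set (Fin d → ℤ)))) :
    IsConnected (fullRegion (D : Set (Fin d → ℤ))) :=
  isConnected_of_homotopyEquiv
    (nonempty_homotopyEquiv_fullRegion (compl_openRegion_nonempty hd D)) h

/-! ### Finite animals and their homotopy types -/

/-- A finite set of sites whose open region is connected. These are the sets that occur as finite
clusters. -/
abbrev Animal (d : ℕ) : Type :=
  {D : Finset (Fin d → ℤ) // IsConnected (openRegion (D : Set (Fin d → ℤ)))}


/-- The homotopy type of the open region of an animal. -/
noncomputable def Animal.type (hd : d ≠ 0) (D : Animal d) : HomotopyType d :=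
  Quotient.mk (homotopySetoid d) (fullComplex D.1 (isConnected_fullRegion hd D.2))

theorem Animal.nonempty_homotopyEquiv (hd : d ≠ 0) (D : Animal d) :
    Nonempty (openRegion (D.1 : Set (Fin d → ℤ)) ≃ₕ
      (fullComplex D.1 (isConnected_fullRegion hd D.2)).space) := by
  rw [space_fullComplex]
  exact nonempty_homotopyEquiv_fullRegion (compl_openRegion_nonempty hd _)

theorem Animal.hasType_iff (hd : d ≠ 0) (D : Animal d) {γ : HomotopyType d} :
    HasType (openRegion (D.1 : Set (Fin d → ℤ))) γ ↔ D.type hd = γ := by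
  obtain ⟨e⟩ := D.nonempty_homotopyEquiv hd
  constructor
  · rintro ⟨K, rfl, ⟨e'⟩⟩
    exact Quotient.sound ⟨e.symm.trans e'⟩
  · rintro rfl
    exact ⟨_, rfl, ⟨e⟩⟩

theorem Animal.type_eq_of_homeomorph (hd : d ≠ 0) {D E : Animal d}
    (h : openRegion (D.1 : Set (Fin d → ℤ)) ≃ₜ openRegion (E.1 : Set (Fin d → ℤ))) :
    D.type hd = E.type hd := by
  obtain ⟨e⟩ := D.nonempty_homotopyEquiv hd
  obtain ⟨e'⟩ := E.nonempty_homotopyEquiv hd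
  exact Quotient.sound ⟨(e.symm.trans h.toHomotopyEquiv).trans e'⟩

theorem Animal.type_surjective (hd : d ≠ 0) :
    Function.Surjective (Animal.type hd : Animal d → HomotopyType d) := by
  intro γ
  induction γ using Quotient.inductionOn with
  | h K =>
    have hcoe : ((finite_doubledSites K).toFinset : Set (Fin d → ℤ)) = doubledSites K :=
      Set.Finite.coe_toFinset _
    obtain ⟨e⟩ := nonempty_homotopyEquiv_doubledSites K
    have hfull : IsConnected (fullRegion (doubledSites K)) :=
      isConnected_of_homotopyEquiv ⟨e.symm⟩ K.connected
    obtain ⟨e'⟩ := nonempty_homotopyEquiv_fullRegion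
      (compl_openRegion_nonempty hd (finite_doubledSites K).toFinset)
    rw [hcoe] at e'
    have hopen : IsConnected (openRegion (doubledSites K)) :=
      isConnected_of_homotopyEquiv ⟨e'.symm⟩ hfull
    refine ⟨⟨(finite_doubledSites K).toFinset, by rwa [hcoe]⟩, ?_⟩
    refine (Animal.hasType_iff hd _).1 ⟨K, rfl, ?_⟩
    rw [hcoe]
    exact ⟨e'.trans e⟩

/-! ### Translations -/

/-- The translate of a set of sites by `x`. -/
def shift (x : Fin d → ℤ) (D : Set (Fin d → ℤ)) : Set (Fin d → ℤ) := {z | z - x ∈ D}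

theorem mem_shift {x z : Fin d → ℤ} {D : Set (Fin d → ℤ)} : z ∈ shift x D ↔ z - x ∈ D := Iff.rfl

theorem shift_neg_shift (x : Fin d → ℤ) (D : Set (Fin d → ℤ)) : shift (-x) (shift x D) = D := by
  ext z
  simp [mem_shift]

theorem shift_shift_neg (x : Fin d → ℤ) (D : Set (Fin d → ℤ)) : shift x (shift (-x) D) = D := by
  ext z
  simp [mem_shift]

theorem mem_unitCube_sub {x z : Fin d → ℤ} {y : Fin d → ℝ} :
    (fun i => y i - x i) ∈ unitCube (z - x) ↔ y ∈ unitCube z := by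
  simp only [mem_unitCube, Pi.sub_apply, Int.cast_sub]
  refine forall_congr' fun i => ?_
  constructor <;> rintro ⟨h1, h2⟩ <;> constructor <;> linarith

theorem mem_openRegion_shift {x : Fin d → ℤ} {D : Set (Fin d → ℤ)} {y : Fin d → ℝ} :
    y ∈ openRegion (shift x D) ↔ (fun i => y i - x i) ∈ openRegion D := by
  constructor
  · intro h w hw
    have h1 := h (w + x) (mem_unitCube_sub (x := x).1 (by simpa using hw))
    simpa [mem_shift] using h1
  · exact fun h z hz => h _ (mem_unitCube_sub.2 hz)

/-- The translation as a homeomorphism between the open regions. -/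
def openRegionShift (x : Fin d → ℤ) (D : Set (Fin d → ℤ)) :
    openRegion D ≃ₜ openRegion (shift x D) where
  toFun y := ⟨fun i => y.1 i + x i, mem_openRegion_shift.2 (by simp)⟩
  invFun y := ⟨fun i => y.1 i - x i, mem_openRegion_shift.1 y.2⟩
  left_inv y := by ext i; simp
  right_inv y := by ext i; simp
  continuous_toFun := Continuous.subtype_mk (by
    refine continuous_pi fun i => ?_
    exact ((continuous_apply i).comp continuous_subtype_val).add continuous_const) _
  continuous_invFun := Continuous.subtype_mk (by
    refine continuous_pi fun i => ?_
    exact ((continuous_apply i).comp continuous_subtype_val).sub continuous_const) _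

theorem isConnected_openRegion_shift {x : Fin d → ℤ} {D : Set (Fin d → ℤ)}
    (h : IsConnected (openRegion D)) : IsConnected (openRegion (shift x D)) :=
  isConnected_of_homotopyEquiv ⟨(openRegionShift x D).toHomotopyEquiv⟩ h

theorem IsCluster.shift {Z D : Set (Fin d → ℤ)} (h : IsCluster Z D) (x : Fin d → ℤ) :
    IsCluster (shift x Z) (shift x D) where
  isConnected := isConnected_openRegion_shift h.isConnected
  subset _ hz := h.subset hz
  closed z hz _ hy hyZ := mem_openRegion_shift.2
    (h.closed (z - x) hz _ (mem_unitCube_sub.2 hy) (mem_openRegion_shift.1 hyZ))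

theorem isCluster_shift_iff {Z D : Set (Fin d → ℤ)} {x : Fin d → ℤ} :
    IsCluster Z (shift x D) ↔ IsCluster (shift (-x) Z) D := by
  constructor
  · intro h
    simpa only [shift_neg_shift] using h.shift (-x)
  · intro h
    simpa only [shift_shift_neg] using h.shift x

/-- The translate of an animal. -/
def Animal.translate (D : Animal d) (x : Fin d → ℤ) : Animal d :=
  ⟨D.1.map (Equiv.addRight x).toEmbedding, by
    have : ((D.1.map (Equiv.addRight x).toEmbedding : Finset (Fin d → ℤ)) : Set (Fin d → ℤ)) =
        CubicalPercolation.shift x D.1 := by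
      ext z
      simp [mem_shift, sub_eq_add_neg]
    rw [this]
    exact isConnected_openRegion_shift D.2⟩

theorem Animal.coe_translate (D : Animal d) (x : Fin d → ℤ) :
    ((D.translate x).1 : Set (Fin d → ℤ)) = CubicalPercolation.shift x D.1 := by
  ext z
  simp [mem_shift, sub_eq_add_neg, Animal.translate]

theorem Animal.mem_translate {D : Animal d} {x z : Fin d → ℤ} :
    z ∈ (D.translate x).1 ↔ z - x ∈ D.1 := by
  rw [← Finset.mem_coe, coe_translate, mem_shift, Finset.mem_coe]

theorem Animal.type_translate (hd : d ≠ 0) (D : Animal d) (x : Fin d → ℤ) :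
    (D.translate x).type hd = D.type hd :=
  (Animal.type_eq_of_homeomorph hd ((openRegionShift x _).trans
    (Homeomorph.setCongr (by rw [D.coe_translate])))).symm

theorem Animal.nonempty (D : Animal d) : D.1.Nonempty := by
  obtain ⟨x, hx⟩ := D.2.nonempty
  exact ⟨_, hx _ (mem_unitCube_floor x)⟩

/-- A shape: an animal with lexicographically smallest site `0`. Every animal is the translate of
exactly one shape. -/
abbrev Shape (d : ℕ) : Type :=
  {C : Animal d // 0 ∈ C.1 ∧ ∀ z ∈ C.1, toLex (0 : Fin d → ℤ) ≤ toLex z}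


theorem bijective_translate :
    Function.Bijective fun q : Shape d × (Fin d → ℤ) => q.1.1.translate q.2 := by
  constructor
  · rintro ⟨C, x⟩ ⟨C', x'⟩ h
    simp only at h
    have key : ∀ (C C' : Shape d) (x x' : Fin d → ℤ), C.1.translate x = C'.1.translate x' →
        toLex x' ≤ toLex x := fun C C' x x' h => by
      have h1 : x ∈ (C.1.translate x).1 := Animal.mem_translate.2 (by simpa using C.2.1)
      rw [h, Animal.mem_translate] at h1
      have h2 := C'.2.2 _ h1
      rw [toLex_sub, toLex_zero] at h2
      exact sub_nonneg.1 h2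
    obtain rfl : x = x' := toLex.injective ((key C' C x' x h.symm).antisymm (key C C' x x' h))
    refine Prod.ext (Subtype.ext (Subtype.ext (Finset.ext fun z => ?_))) rfl
    have h1 : z + x ∈ (C.1.translate x).1 ↔ z + x ∈ (C'.1.translate x).1 := by rw [h]
    simpa [Animal.mem_translate] using h1
  · intro D
    obtain ⟨x, hx, hmin⟩ := D.1.exists_min_image (fun z => toLex z) D.nonempty
    refine ⟨(⟨D.translate (-x), ?_, ?_⟩, x), ?_⟩
    · simpa [Animal.mem_translate] using hx
    · intro z hz
      have h1 := hmin _ (Animal.mem_translate.1 hz)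
      rw [sub_neg_eq_add, toLex_add] at h1
      rw [toLex_zero]
      exact nonneg_of_le_add_left h1
    · refine Subtype.ext (Finset.ext fun z => ?_)
      simp [Animal.mem_translate]

theorem exists_shape_type (hd : d ≠ 0) (γ : HomotopyType d) : ∃ C : Shape d, C.1.type hd = γ := by
  obtain ⟨D, rfl⟩ := Animal.type_surjective hd γ
  obtain ⟨⟨C, x⟩, rfl⟩ := bijective_translate.2 D
  exact ⟨C, (C.1.type_translate hd x).symm⟩

/-! ### Events that depend on finitely many sites -/

/-- The event `A` depends only on the colors of the sites in `S`. -/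
def IsLocal {ι : Type*} (S : Finset ι) (A : Set (Set ι)) : Prop :=
  ∀ Z Z' : Set ι, (∀ x ∈ S, x ∈ Z ↔ x ∈ Z') → Z ∈ A → Z' ∈ A

theorem IsLocal.exists_preimage {ι : Type*} {S : Finset ι} {A : Set (Set ι)} (h : IsLocal S A) :
    ∃ B : Set (S → Prop), MeasurableSet B ∧ A = (fun Z (i : S) => (i : ι) ∈ Z) ⁻¹' B := by
  refine ⟨(fun Z (i : S) => (i : ι) ∈ Z) '' A, (Set.toFinite _).measurableSet, ?_⟩
  refine (Set.subset_preimage_image _ _).antisymm ?_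
  rintro Z ⟨Z', hZ', hZZ'⟩
  exact h Z' Z (fun x hx => by simpa using congrFun hZZ' ⟨x, hx⟩) hZ'

theorem IsLocal.measurableSet {ι : Type*} {S : Finset ι} {A : Set (Set ι)} (h : IsLocal S A) :
    MeasurableSet A := by
  obtain ⟨B, hB, rfl⟩ := h.exists_preimage
  exact measurable_pi_lambda _ (fun i : S => measurable_set_mem (i : ι)) hB

/-- The sites of the cubes that meet a cube of `D`. -/
noncomputable def neighborhood (D : Finset (Fin d → ℤ)) : Finset (Fin d → ℤ) :=
  D.biUnion fun z => Finset.Icc (z - 1) (z + 1)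

theorem mem_neighborhood {D : Finset (Fin d → ℤ)} {w : Fin d → ℤ} :
    w ∈ neighborhood D ↔ ∃ z ∈ D, w ∈ Finset.Icc (z - 1) (z + 1) := by
  simp [neighborhood]

theorem mem_neighborhood_of_mem {D : Finset (Fin d → ℤ)} {z : Fin d → ℤ} (hz : z ∈ D) :
    z ∈ neighborhood D :=
  mem_neighborhood.2 ⟨z, hz, Finset.mem_Icc.2 ⟨by simp, by simp⟩⟩

theorem mem_neighborhood_of_mem_unitCube {D : Finset (Fin d → ℤ)} {z w : Fin d → ℤ} (hz : z ∈ D)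
    {x : Fin d → ℝ} (hxz : x ∈ unitCube z) (hxw : x ∈ unitCube w) : w ∈ neighborhood D := by
  refine mem_neighborhood.2 ⟨z, hz, Finset.mem_Icc.2 ⟨fun i => ?_, fun i => ?_⟩⟩
  all_goals
    have h1 := mem_unitCube.1 hxz i
    have h2 := mem_unitCube.1 hxw i
    simp only [Pi.sub_apply, Pi.add_apply, Pi.one_apply]
  · have : (z i : ℝ) ≤ ((w i + 1 : ℤ) : ℝ) := by push_cast; linarith
    have := Int.cast_le.1 this
    omega
  · have : (w i : ℝ) ≤ ((z i + 1 : ℤ) : ℝ) := by push_cast; linarith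
    exact Int.cast_le.1 this

theorem isLocal_isCluster (D : Finset (Fin d → ℤ)) :
    IsLocal (neighborhood D) {Z | IsCluster Z D} := fun _ _ h hZ =>
  ⟨hZ.isConnected, fun z hz => (h z (mem_neighborhood_of_mem hz)).1 (hZ.subset hz),
    fun z hz x hx hxZ => hZ.closed z hz x hx fun w hw =>
      (h w (mem_neighborhood_of_mem_unitCube hz hx hw)).2 (hxZ w hw)⟩

/-- An animal is a cluster if its sites are black and all other sites nearby are white. -/
theorem isCluster_of_neighborhood {Z : Set (Fin d → ℤ)} (D : Animal d)
    (h : ∀ z ∈ neighborhood D.1, z ∈ Z ↔ z ∈ D.1) : IsCluster Z D.1 where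
  isConnected := D.2
  subset z hz := (h z (mem_neighborhood_of_mem hz)).2 hz
  closed _ hz _ hx hxZ w hw := (h w (mem_neighborhood_of_mem_unitCube hz hx hw)).1 (hxZ w hw)

/-! ### The law of Bernoulli percolation -/

section law

variable {Ω : Type*} [MeasurableSpace Ω] {P : Measure Ω} {Z : Ω → Set (Fin d → ℤ)}

theorem IsBernoulliPercolation.measurable {p : ℝ} (h : IsBernoulliPercolation P p Z) :
    Measurable Z :=
  measurable_set_iff.2 fun x => measurableSet_setOfPred.1 (h.measurableSet_mem x)

theorem IsBernoulliPercolation.iIndepFun {p : ℝ} (h : IsBernoulliPercolation P p Z) :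
    iIndepFun (fun x ω => x ∈ Z ω) P := by
  have h1 := (iIndepSet_iff_iIndep _ _).1 h.indep
  simp only [MeasurableSpace.generateFrom_singleton] at h1
  exact (iIndepFun_iff_iIndep _ _ _).2 h1

/-- The joint law of the colors of all sites. -/
theorem IsBernoulliPercolation.map_eq [IsProbabilityMeasure P] {q : unitInterval}
    (h : IsBernoulliPercolation P q Z) :
    P.map Z = setBernoulli Set.univ q := by
  have hm : ∀ x, Measurable fun ω => x ∈ Z ω := fun x =>
    measurableSet_setOfPred.1 (h.measurableSet_mem x)
  have h1 := h.iIndepFun.map_fun_eq_infinitePi_map hm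
  have h2 : ∀ x, P.map (fun ω => x ∈ Z ω) =
      (unitInterval.toNNReal q • Measure.dirac (x ∈ (Set.univ : Set (Fin d → ℤ))) +
        unitInterval.toNNReal (unitInterval.symm q) • Measure.dirac False : Measure Prop) := by
    intro x
    have hq : P {ω | x ∈ Z ω} = (unitInterval.toNNReal q : ℝ≥0∞) := by
      rw [h.prob_mem x, ENNReal.ofReal]
      congr 1
      ext
      simp [q.2.1]
    have hq' : P {ω | x ∉ Z ω} = (unitInterval.toNNReal (unitInterval.symm q) : ℝ≥0∞) := by
      have : {ω | x ∉ Z ω} = {ω | x ∈ Z ω}ᶜ := rfl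
      rw [this, prob_compl_eq_one_sub (h.measurableSet_mem x), h.prob_mem x,
        ← ENNReal.ofReal_one, ← ENNReal.ofReal_sub _ q.2.1, ENNReal.ofReal]
      congr 1
      ext
      simp [q.2.2]
    refine Measure.ext_of_singleton fun b => ?_
    rw [Measure.map_apply (hm x) (Set.toFinite _).measurableSet]
    by_cases hb : b
    · have : (fun ω => x ∈ Z ω) ⁻¹' {b} = {ω | x ∈ Z ω} := by ext ω; simp [hb]
      rw [this, hq]
      simp [hb]
    · have : (fun ω => x ∈ Z ω) ⁻¹' {b} = {ω | x ∉ Z ω} := by ext ω; simp [hb]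
      rw [this, hq']
      simp [hb]
  simp only [h2] at h1
  rw [setBernoulli_eq_map, ← h1, Measure.map_map]
  · rfl
  · exact measurable_set_iff.2 fun x => measurable_pi_apply x
  · exact measurable_pi_lambda _ hm

theorem IsBernoulliPercolation.shift {p : ℝ} (h : IsBernoulliPercolation P p Z)
    (x : Fin d → ℤ) : IsBernoulliPercolation P p fun ω => shift x (Z ω) where
  measurableSet_mem z := h.measurableSet_mem (z - x)
  indep := by
    have := h.indep.precomp (g := fun z => z - x) (sub_left_injective)
    exact this
  prob_mem z := h.prob_mem (z - x)

/-- Events depending on disjoint finite sets of sites are independent. -/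
theorem IsBernoulliPercolation.prob_inter {p : ℝ} (h : IsBernoulliPercolation P p Z)
    {S T : Finset (Fin d → ℤ)} (hST : Disjoint S T) {A B : Set (Set (Fin d → ℤ))}
    (hA : IsLocal S A) (hB : IsLocal T B) :
    P (Z ⁻¹' A ∩ Z ⁻¹' B) = P (Z ⁻¹' A) * P (Z ⁻¹' B) := by
  obtain ⟨A', hA', rfl⟩ := hA.exists_preimage
  obtain ⟨B', hB', rfl⟩ := hB.exists_preimage
  exact (h.iIndepFun.indepFun_finset S T hST fun x =>
    measurableSet_setOfPred.1 (h.measurableSet_mem x)).measure_inter_preimage_eq_mul _ _ hA' hB'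

end law

/-! ### The density of a shape -/

/-- The probability that the animal `D` is a cluster. -/
noncomputable def density (q : unitInterval) (D : Animal d) : ℝ :=
  (setBernoulli (Set.univ : Set (Fin d → ℤ)) q).real {Z | IsCluster Z D.1}

theorem density_nonneg (q : unitInterval) (D : Animal d) : 0 ≤ density q D := measureReal_nonneg

theorem IsBernoulliPercolation.prob_isCluster {Ω : Type*} [MeasurableSpace Ω] {P : Measure Ω}
    [IsProbabilityMeasure P] {Z : Ω → Set (Fin d → ℤ)} {q : unitInterval}
    (h : IsBernoulliPercolation P q Z) (D : Animal d) :
    P.real {ω | IsCluster (Z ω) D.1} = density q D := by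
  rw [density, ← h.map_eq, map_measureReal_apply h.measurable (isLocal_isCluster _).measurableSet]
  rfl

theorem IsBernoulliPercolation.prob_isCluster_translate {Ω : Type*} [MeasurableSpace Ω]
    {P : Measure Ω} [IsProbabilityMeasure P] {Z : Ω → Set (Fin d → ℤ)} {q : unitInterval}
    (h : IsBernoulliPercolation P q Z) (D : Animal d) (x : Fin d → ℤ) :
    P.real {ω | IsCluster (Z ω) (D.translate x).1} = density q D := by
  simp only [Animal.coe_translate, isCluster_shift_iff]
  exact (h.shift (-x)).prob_isCluster D

theorem density_pos {q : unitInterval} (h0 : 0 < q) (h1 : q < 1) (D : Animal d) :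
    0 < density q D := by
  classical
  have hq : (unitInterval.toNNReal q : ℝ≥0∞) ≠ 0 := by
    simpa [← NNReal.coe_ne_zero] using fun h => h0.ne' (Subtype.ext h)
  have hq' : (unitInterval.toNNReal (unitInterval.symm q) : ℝ≥0∞) ≠ 0 := by
    have : (q : ℝ) < 1 := h1
    rw [ENNReal.coe_ne_zero, ← NNReal.coe_ne_zero]
    simp only [unitInterval.coe_toNNReal, unitInterval.coe_symm_eq]
    linarith
  refine ENNReal.toReal_pos (pos_iff_ne_zero.1 ?_) (measure_ne_top _ _)
  rw [setBernoulli_apply']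
  have hsub : Set.pi (neighborhood D.1 : Set (Fin d → ℤ)) (fun z => {z ∈ D.1}) ⊆
      (fun p : (Fin d → ℤ) → Prop => {i | p i}) ⁻¹' {Z | IsCluster Z D.1} := fun v hv =>
    isCluster_of_neighborhood D fun z hz => by
      have : v z = (z ∈ D.1) := hv z hz
      exact iff_of_eq this
  refine lt_of_lt_of_le ?_ (measure_mono hsub)
  rw [Measure.infinitePi_pi _ fun _ _ => (Set.toFinite _).measurableSet]
  refine pos_iff_ne_zero.2 (Finset.prod_ne_zero_iff.2 fun z _ => ?_)
  by_cases hz : z ∈ D.1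
  · simpa [hz] using ENNReal.coe_ne_zero.1 hq
  · simpa [hz] using ENNReal.coe_ne_zero.1 hq'

/-- Two clusters that share a site are equal. -/
theorem IsCluster.eq_of_mem {Z : Set (Fin d → ℤ)} {D E : Finset (Fin d → ℤ)} (hD : IsCluster Z D)
    (hE : IsCluster Z E) {z : Fin d → ℤ} (hzD : z ∈ D) (hzE : z ∈ E) : D = E := by
  have h1 := hD.connectedComponentIn_eq D.finite_toSet (cubeCenter_mem_openRegion.2 hzD)
  have h2 := hE.connectedComponentIn_eq E.finite_toSet (cubeCenter_mem_openRegion.2 hzE)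
  exact Finset.coe_injective (openRegion_injective (h1.symm.trans h2))

/-- The densities of the shapes are summable, as the site `0` lies in at most one cluster. -/
theorem summable_density (q : unitInterval) : Summable fun C : Shape d => density q C.1 := by
  have h := tsum_measure_le_measure_univ (μ := setBernoulli (Set.univ : Set (Fin d → ℤ)) q)
    (s := fun C : Shape d => {Z | IsCluster Z C.1.1})
    (fun C => (isLocal_isCluster _).measurableSet.nullMeasurableSet) (fun C C' hCC' =>
      Disjoint.aedisjoint (Set.disjoint_left.2 fun Z hZ hZ' => hCC' (Subtype.ext (Subtype.ext
        (IsCluster.eq_of_mem hZ hZ' C.2.1 C'.2.1)))))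
  refine ENNReal.summable_toReal (ne_top_of_le_ne_top (measure_ne_top _ _) h)

/-! ### Counting the positions of an animal in the window -/

theorem floor_half_add_ceil_half (L : ℕ) : ⌊(L : ℝ) / 2⌋ + ⌈(L : ℝ) / 2⌉ = L := by
  rcases Nat.even_or_odd' L with ⟨k, rfl | rfl⟩
  · have : ((2 * k : ℕ) : ℝ) / 2 = ((k : ℤ) : ℝ) := by push_cast; ring
    rw [this, Int.floor_intCast, Int.ceil_intCast]
    push_cast; ring
  · have h1 : ⌊((2 * k + 1 : ℕ) : ℝ) / 2⌋ = k := by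
      rw [Int.floor_eq_iff]; push_cast; constructor <;> linarith
    have h2 : ⌈((2 * k + 1 : ℕ) : ℝ) / 2⌉ = k + 1 := by
      rw [Int.ceil_eq_iff]; push_cast; constructor <;> linarith
    rw [h1, h2]
    push_cast; ring

theorem card_boxSites (L : ℕ) : (boxSites d L).card = L ^ d := by
  have h := floor_half_add_ceil_half L
  rw [boxSites, Pi.card_Icc]
  simp only [Int.card_Icc, Finset.prod_const, Finset.card_univ, Fintype.card_fin]
  congr 1
  omega

/-- The translations that move the animal `D` into the window. The condition `x ∈ boxSites d L` is
automatic for shapes. -/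
noncomputable def positions (D : Animal d) (L : ℕ) : Finset (Fin d → ℤ) :=
  (boxSites d L).filter fun x => (D.translate x).1 ⊆ boxSites d L

theorem mem_positions (C : Shape d) {L : ℕ} {x : Fin d → ℤ} :
    x ∈ positions C.1 L ↔ (C.1.translate x).1 ⊆ boxSites d L := by
  rw [positions, Finset.mem_filter, and_iff_right_iff_imp]
  exact fun h => h (Animal.mem_translate.2 (by simpa using C.2.1))

theorem card_positions_le (D : Animal d) (L : ℕ) : (positions D L).card ≤ L ^ d :=
  (Finset.card_filter_le _ _).trans_eq (card_boxSites L)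

theorem exists_card_positions_ge (D : Animal d) :
    ∃ R : ℕ, ∀ L : ℕ, (L - 2 * R) ^ d ≤ (positions D L).card := by
  obtain ⟨R, hR⟩ : ∃ R : ℕ, ∀ z ∈ D.1, ∀ i, (z i).natAbs ≤ R := by
    refine ⟨D.1.sup fun z => Finset.univ.sup fun i => (z i).natAbs, fun z hz i => ?_⟩
    exact (Finset.le_sup (f := fun i => (z i).natAbs) (Finset.mem_univ i)).trans
      (Finset.le_sup (f := fun z : Fin d → ℤ => Finset.univ.sup fun i => (z i).natAbs) hz)
  refine ⟨R, fun L => ?_⟩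
  have h := floor_half_add_ceil_half L
  have hsub : Finset.Icc (fun _ => -⌊(L : ℝ) / 2⌋ + R) (fun _ : Fin d => ⌈(L : ℝ) / 2⌉ - 1 - R) ⊆
      positions D L := by
    intro x hx
    obtain ⟨hx1, hx2⟩ := Finset.mem_Icc.1 hx
    refine Finset.mem_filter.2 ⟨mem_boxSites.2 fun i => ?_, fun z hz => mem_boxSites.2 fun i => ?_⟩
    · have h1 := hx1 i
      have h2 := hx2 i
      simp only at h1 h2
      omega
    · have h1 := hx1 i
      have h2 := hx2 i
      have h3 := hR _ (Animal.mem_translate.1 hz) i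
      simp only [Pi.sub_apply] at h1 h2 h3
      omega
  refine le_of_eq_of_le ?_ (Finset.card_le_card hsub)
  rw [Pi.card_Icc]
  simp only [Int.card_Icc, Finset.prod_const, Finset.card_univ, Fintype.card_fin]
  congr 1
  omega

theorem tendsto_card_positions (D : Animal d) :
    Tendsto (fun L : ℕ => ((positions D L).card : ℝ) / (L : ℝ) ^ d) atTop (𝓝 1) := by
  obtain ⟨R, hR⟩ := exists_card_positions_ge D
  have h1 : Tendsto (fun L : ℕ => (1 - (2 * R : ℝ) / L) ^ d) atTop (𝓝 1) := by
    have := ((tendsto_const_nhds (x := (1 : ℝ))).sub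
      (tendsto_const_div_atTop_nhds_zero_nat (2 * R : ℝ))).pow d
    simpa using this
  refine tendsto_of_tendsto_of_tendsto_of_le_of_le' h1 tendsto_const_nhds ?_ ?_
  · filter_upwards [eventually_ge_atTop (2 * R + 1)] with L hL
    have hL0 : (0 : ℝ) < L := by exact_mod_cast (by omega : 0 < L)
    have h2 : (((L - 2 * R : ℕ) : ℝ)) ^ d ≤ (positions D L).card := by exact_mod_cast hR L
    rw [Nat.cast_sub (by omega)] at h2
    rw [le_div_iff₀ (by positivity), ← mul_pow]
    have h3 : (1 - (2 * R : ℝ) / L) * L = L - ((2 * R : ℕ) : ℝ) := by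
      push_cast
      field_simp
    rwa [h3]
  · refine Eventually.of_forall fun L => div_le_one_of_le₀ ?_ (by positivity)
    exact_mod_cast card_positions_le D L

/-- The number of translates of `D` in the window that are clusters of `Z`. -/
noncomputable def clusterCount (D : Animal d) (L : ℕ) (Z : Set (Fin d → ℤ)) : ℝ :=
  ∑ x ∈ positions D L, {Z | IsCluster Z (D.translate x).1}.indicator 1 Z

theorem clusterCount_nonneg (D : Animal d) (L : ℕ) (Z : Set (Fin d → ℤ)) :
    0 ≤ clusterCount D L Z :=
  Finset.sum_nonneg fun _ _ => Set.indicator_nonneg (fun _ _ => zero_le_one) _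

/-! ### The law of large numbers for one animal -/

/-- The event that the translate of `D` by `x` is a cluster. -/
def clusterEvent {Ω : Type*} (Z : Ω → Set (Fin d → ℤ)) (D : Animal d) (x : Fin d → ℤ) : Set Ω :=
  {ω | IsCluster (Z ω) (D.translate x).1}

theorem clusterCount_eq {Ω : Type*} (Z : Ω → Set (Fin d → ℤ)) (D : Animal d) (L : ℕ) :
    (fun ω => clusterCount D L (Z ω)) =
      ∑ x ∈ positions D L, (clusterEvent Z D x).indicator (1 : Ω → ℝ) := by
  ext ω
  rw [clusterCount, Finset.sum_apply]
  rfl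

theorem IsBernoulliPercolation.measurableSet_clusterEvent {Ω : Type*} [MeasurableSpace Ω]
    {P : Measure Ω} {Z : Ω → Set (Fin d → ℤ)} {p : ℝ} (h : IsBernoulliPercolation P p Z)
    (D : Animal d) (x : Fin d → ℤ) : MeasurableSet (clusterEvent Z D x) :=
  h.measurable (isLocal_isCluster (D.translate x).1).measurableSet

/-- The mean absolute deviation of the number of clusters per site from the density. -/
noncomputable def deviation {Ω : Type*} [MeasurableSpace Ω] (P : Measure Ω)
    (Z : Ω → Set (Fin d → ℤ)) (q : unitInterval) (D : Animal d) (L : ℕ) : ℝ :=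
  ∫ ω, |clusterCount D L (Z ω) / (L : ℝ) ^ d - density q D| ∂P

theorem deviation_nonneg {Ω : Type*} [MeasurableSpace Ω] {P : Measure Ω}
    {Z : Ω → Set (Fin d → ℤ)} {q : unitInterval} (D : Animal d) (L : ℕ) :
    0 ≤ deviation P Z q D L := integral_nonneg fun _ => abs_nonneg _

section lln

variable {Ω : Type*} [MeasurableSpace Ω] {P : Measure Ω} [IsProbabilityMeasure P]
  {Z : Ω → Set (Fin d → ℤ)} {q : unitInterval}

theorem IsBernoulliPercolation.memLp_clusterEvent (h : IsBernoulliPercolation P q Z)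
    (D : Animal d) (x : Fin d → ℤ) :
    MemLp ((clusterEvent Z D x).indicator (1 : Ω → ℝ)) 2 P :=
  memLp_indicator_const 2 (h.measurableSet_clusterEvent D x) (1 : ℝ) (Or.inr (measure_ne_top _ _))

theorem IsBernoulliPercolation.integral_clusterEvent (h : IsBernoulliPercolation P q Z)
    (D : Animal d) (x : Fin d → ℤ) :
    ∫ ω, (clusterEvent Z D x).indicator (1 : Ω → ℝ) ω ∂P = density q D := by
  rw [integral_indicator_one (h.measurableSet_clusterEvent D x)]
  exact h.prob_isCluster_translate D x

theorem IsBernoulliPercolation.covariance_clusterEvent (h : IsBernoulliPercolation P q Z)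
    (D : Animal d) (x y : Fin d → ℤ) :
    cov[(clusterEvent Z D x).indicator (1 : Ω → ℝ), (clusterEvent Z D y).indicator (1 : Ω → ℝ); P] =
      P.real (clusterEvent Z D x ∩ clusterEvent Z D y) - density q D * density q D := by
  rw [covariance_eq_sub (h.memLp_clusterEvent D x) (h.memLp_clusterEvent D y),
    h.integral_clusterEvent, h.integral_clusterEvent, ← Set.inter_indicator_one,
    integral_indicator_one ((h.measurableSet_clusterEvent D x).inter
      (h.measurableSet_clusterEvent D y))]

theorem neighborhood_translate (D : Animal d) (x w : Fin d → ℤ) :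
    w ∈ neighborhood (D.translate x).1 ↔ w - x ∈ neighborhood D.1 := by
  simp only [mem_neighborhood, Animal.mem_translate, Finset.mem_Icc]
  constructor
  · rintro ⟨z, hz, h1, h2⟩
    refine ⟨z - x, hz, ?_, ?_⟩
    · rw [sub_right_comm]; exact sub_le_sub_right h1 x
    · rw [sub_add_eq_add_sub]; exact sub_le_sub_right h2 x
  · rintro ⟨z, hz, h1, h2⟩
    refine ⟨z + x, by simpa using hz, ?_, ?_⟩
    · rw [add_sub_right_comm]; exact add_le_of_le_sub_right h1
    · rw [add_right_comm]; exact sub_le_iff_le_add.1 h2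

/-- The covariance is at most `1`, and vanishes unless the neighborhoods of the two translates
intersect. -/
theorem IsBernoulliPercolation.covariance_clusterEvent_le (h : IsBernoulliPercolation P q Z)
    (D : Animal d) (x y : Fin d → ℤ) :
    cov[(clusterEvent Z D x).indicator (1 : Ω → ℝ), (clusterEvent Z D y).indicator (1 : Ω → ℝ); P] ≤
      if y ∈ (neighborhood D.1 ×ˢ neighborhood D.1).image (fun s => x + s.1 - s.2) then 1
        else 0 := by
  rw [h.covariance_clusterEvent]
  split_ifs with hy
  · have h1 : P.real (clusterEvent Z D x ∩ clusterEvent Z D y) ≤ 1 := measureReal_le_one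
    have h2 := mul_nonneg (density_nonneg q D) (density_nonneg q D)
    linarith
  · have hdisj : Disjoint (neighborhood (D.translate x).1) (neighborhood (D.translate y).1) := by
      refine Finset.disjoint_left.2 fun w hw hw' => hy ?_
      rw [neighborhood_translate] at hw hw'
      exact Finset.mem_image.2 ⟨(w - x, w - y), Finset.mem_product.2 ⟨hw, hw'⟩, by simp⟩
    have h1 := h.prob_inter hdisj (isLocal_isCluster _) (isLocal_isCluster _)
    have h2 : P.real (clusterEvent Z D x ∩ clusterEvent Z D y) =
        P.real (clusterEvent Z D x) * P.real (clusterEvent Z D y) := by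
      simp only [measureReal_def, ← ENNReal.toReal_mul]
      exact congrArg _ h1
    rw [h2, clusterEvent, clusterEvent, h.prob_isCluster_translate, h.prob_isCluster_translate,
      sub_self]

theorem IsBernoulliPercolation.memLp_clusterCount (h : IsBernoulliPercolation P q Z)
    (D : Animal d) (L : ℕ) : MemLp (fun ω => clusterCount D L (Z ω)) 2 P := by
  rw [clusterCount_eq]
  exact memLp_finsetSum' _ fun x _ => h.memLp_clusterEvent D x

theorem IsBernoulliPercolation.integral_clusterCount (h : IsBernoulliPercolation P q Z)
    (D : Animal d) (L : ℕ) :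
    ∫ ω, clusterCount D L (Z ω) ∂P = (positions D L).card * density q D := by
  change ∫ ω, ∑ x ∈ positions D L, (clusterEvent Z D x).indicator (1 : Ω → ℝ) ω ∂P = _
  rw [integral_finsetSum _ fun x _ => (h.memLp_clusterEvent D x).integrable one_le_two]
  simp [h.integral_clusterEvent]

theorem IsBernoulliPercolation.variance_clusterCount_le (h : IsBernoulliPercolation P q Z)
    (D : Animal d) (L : ℕ) :
    Var[fun ω => clusterCount D L (Z ω); P] ≤ (L : ℝ) ^ d * ((neighborhood D.1).card : ℝ) ^ 2 := by
  rw [clusterCount_eq, variance_sum' fun x _ => h.memLp_clusterEvent D x]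
  have h1 : ∀ x ∈ positions D L, ∑ y ∈ positions D L,
      cov[(clusterEvent Z D x).indicator (1 : Ω → ℝ),
        (clusterEvent Z D y).indicator (1 : Ω → ℝ); P] ≤ ((neighborhood D.1).card : ℝ) ^ 2 := by
    intro x _
    refine (Finset.sum_le_sum fun y _ => h.covariance_clusterEvent_le D x y).trans ?_
    rw [Finset.sum_ite_mem, Finset.sum_const, nsmul_eq_mul, mul_one]
    have h2 := (Finset.card_le_card (Finset.inter_subset_right (s₁ := positions D L))).trans
      (Finset.card_image_le (s := neighborhood D.1 ×ˢ neighborhood D.1)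
        (f := fun s => x + s.1 - s.2))
    rw [Finset.card_product, ← sq] at h2
    exact_mod_cast h2
  refine (Finset.sum_le_sum h1).trans ?_
  rw [Finset.sum_const, nsmul_eq_mul]
  gcongr
  exact_mod_cast card_positions_le D L

theorem IsBernoulliPercolation.integrable_clusterCount_div (h : IsBernoulliPercolation P q Z)
    (D : Animal d) (L : ℕ) :
    Integrable (fun ω => clusterCount D L (Z ω) / (L : ℝ) ^ d) P :=
  ((h.memLp_clusterCount D L).integrable one_le_two).div_const _

theorem IsBernoulliPercolation.deviation_le (h : IsBernoulliPercolation P q Z)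
    (D : Animal d) (L : ℕ) : deviation P Z q D L ≤ 2 * density q D := by
  have hint := h.integrable_clusterCount_div D L
  have h1 : deviation P Z q D L ≤ ∫ ω, (clusterCount D L (Z ω) / (L : ℝ) ^ d + density q D) ∂P := by
    refine integral_mono (hint.sub (integrable_const _)).abs (hint.add (integrable_const _))
      fun ω => ?_
    have h2 : 0 ≤ clusterCount D L (Z ω) / (L : ℝ) ^ d :=
      div_nonneg (clusterCount_nonneg D L _) (by positivity)
    have h3 := density_nonneg q D
    rw [abs_le]
    constructor <;> linarith
  rw [integral_add hint (integrable_const _), integral_div, h.integral_clusterCount] at h1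
  have h2 : ((positions D L).card : ℝ) * density q D / (L : ℝ) ^ d ≤ density q D := by
    rw [mul_div_right_comm]
    refine mul_le_of_le_one_left (density_nonneg q D) (div_le_one_of_le₀ ?_ (by positivity))
    exact_mod_cast card_positions_le D L
  simp only [integral_const, probReal_univ, one_smul] at h1
  linarith

/-- The first absolute moment of the centered variable is at most the standard deviation. -/
theorem integral_abs_sub_le_sqrt_variance {X : Ω → ℝ} (hX : MemLp X 2 P) :
    ∫ ω, |X ω - ∫ ω', X ω' ∂P| ∂P ≤ √(Var[X; P]) := by
  have hY : MemLp (fun ω => |X ω - ∫ ω', X ω' ∂P|) 2 P := (hX.sub (memLp_const _)).abs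
  refine Real.le_sqrt_of_sq_le ?_
  have h1 := variance_nonneg (fun ω => |X ω - ∫ ω', X ω' ∂P|) P
  rw [variance_eq_sub hY] at h1
  rw [variance_eq_integral hX.aemeasurable]
  simp only [Pi.pow_apply, sq_abs] at h1
  linarith

theorem IsBernoulliPercolation.tendsto_deviation (hd : d ≠ 0) (h : IsBernoulliPercolation P q Z)
    (D : Animal d) : Tendsto (deviation P Z q D) atTop (𝓝 0) := by
  have hbound : ∀ L : ℕ, deviation P Z q D L ≤
      √((L : ℝ) ^ d * ((neighborhood D.1).card : ℝ) ^ 2) / (L : ℝ) ^ d +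
        |((positions D L).card : ℝ) / (L : ℝ) ^ d - 1| * density q D := by
    intro L
    have hX := h.memLp_clusterCount D L
    have h1 := (integral_abs_sub_le_sqrt_variance hX).trans
      (Real.sqrt_le_sqrt (h.variance_clusterCount_le D L))
    rw [h.integral_clusterCount] at h1
    have hi1 : Integrable
        (fun ω => |clusterCount D L (Z ω) - (positions D L).card * density q D|) P :=
      ((hX.integrable one_le_two).sub (integrable_const _)).abs
    have h2 : deviation P Z q D L ≤
        ∫ ω, (|clusterCount D L (Z ω) - (positions D L).card * density q D| / (L : ℝ) ^ d +
          |((positions D L).card : ℝ) / (L : ℝ) ^ d - 1| * density q D) ∂P := by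
      refine integral_mono ((h.integrable_clusterCount_div D L).sub (integrable_const _)).abs
        ((hi1.div_const _).add (integrable_const _)) fun ω => ?_
      have h3 : |clusterCount D L (Z ω) - (positions D L).card * density q D| / (L : ℝ) ^ d =
          |(clusterCount D L (Z ω) - (positions D L).card * density q D) / (L : ℝ) ^ d| := by
        rw [abs_div, abs_of_nonneg (by positivity : (0 : ℝ) ≤ (L : ℝ) ^ d)]
      have h4 : |((positions D L).card : ℝ) / (L : ℝ) ^ d - 1| * density q D =
          |(((positions D L).card : ℝ) / (L : ℝ) ^ d - 1) * density q D| := by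
        rw [abs_mul, abs_of_nonneg (density_nonneg q D)]
      simp only
      rw [h3, h4]
      refine le_of_eq_of_le ?_ (abs_add_le _ _)
      congr 1
      ring
    rw [integral_add (hi1.div_const _) (integrable_const _), integral_div] at h2
    simp only [integral_const, probReal_univ, one_smul] at h2
    refine h2.trans ?_
    gcongr
  refine _root_.squeeze_zero (fun L => deviation_nonneg D L) hbound ?_
  have h1 : Tendsto (fun L : ℕ => √((L : ℝ) ^ d * ((neighborhood D.1).card : ℝ) ^ 2) /
      (L : ℝ) ^ d) atTop (𝓝 0) := by
    have h2 : ∀ L : ℕ, √((L : ℝ) ^ d * ((neighborhood D.1).card : ℝ) ^ 2) / (L : ℝ) ^ d =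
        (neighborhood D.1).card / √((L : ℝ) ^ d) := fun L => by
      rw [Real.sqrt_mul (by positivity), Real.sqrt_sq (by positivity), mul_comm, mul_div_assoc,
        Real.sqrt_div_self, ← div_eq_mul_inv]
    simp only [h2]
    refine tendsto_const_nhds.div_atTop (Real.tendsto_sqrt_atTop.comp ?_)
    exact (tendsto_pow_atTop hd).comp tendsto_natCast_atTop_atTop
  have h2 := ((tendsto_card_positions D).sub_const 1).abs.mul_const (density q D)
  simpa using h1.add h2

theorem IsBernoulliPercolation.tendsto_tsum_deviation (hd : d ≠ 0)
    (h : IsBernoulliPercolation P q Z) :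
    Tendsto (fun L : ℕ => ∑' C : Shape d, deviation P Z q C.1 L) atTop (𝓝 0) := by
  have h1 := tendsto_tsum_of_dominated_convergence (𝓕 := atTop)
    (f := fun L : ℕ => fun C : Shape d => deviation P Z q C.1 L) (g := fun _ => 0)
    ((summable_density q).mul_left 2) (fun C => h.tendsto_deviation hd C.1)
    (Eventually.of_forall fun L C => by
      rw [Real.norm_of_nonneg (deviation_nonneg C.1 L)]
      exact h.deviation_le C.1 L)
  simpa using h1

end lln

/-! ### The homotopy measure in terms of shapes -/

/-- The clusters of `Z` inside the window whose homotopy type belongs to `T`. -/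
def clustersIn (hd : d ≠ 0) (L : ℕ) (Z : Set (Fin d → ℤ)) (T : Set (HomotopyType d)) :
    Set (Animal d) :=
  {D | IsCluster Z D.1 ∧ D.1 ⊆ boxSites d L ∧ D.type hd ∈ T}

theorem finite_clustersIn (hd : d ≠ 0) (L : ℕ) (Z : Set (Fin d → ℤ)) (T : Set (HomotopyType d)) :
    (clustersIn hd L Z T).Finite := by
  refine Set.Finite.of_finite_image (f := Subtype.val) ?_ Subtype.val_injective.injOn
  refine (boxSites d L).powerset.finite_toSet.subset ?_
  rintro _ ⟨D, hD, rfl⟩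
  simpa using hD.2.1

theorem ncard_componentsIn_hasType (hd : d ≠ 0) (L : ℕ) (Z : Set (Fin d → ℤ))
    (γ : HomotopyType d) :
    {s ∈ componentsIn (blackRegion Z) (window L 0) | HasType s γ}.ncard =
      (clustersIn hd L Z {γ}).ncard := by
  rw [← Set.ncard_image_of_injective (clustersIn hd L Z {γ})
    (f := fun D : Animal d => openRegion (D.1 : Set (Fin d → ℤ)))
    (openRegion_injective.comp (Finset.coe_injective.comp Subtype.val_injective)),
    componentsIn_blackRegion]
  congr 1
  ext s
  constructor
  · rintro ⟨⟨D, ⟨hD, hDL⟩, rfl⟩, hs⟩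
    exact ⟨⟨D, hD.isConnected⟩, ⟨hD, hDL, (Animal.hasType_iff hd ⟨D, hD.isConnected⟩).1 hs⟩, rfl⟩
  · rintro ⟨D, ⟨hD, hDL, hDγ⟩, rfl⟩
    exact ⟨⟨D.1, ⟨hD, hDL⟩, rfl⟩, (D.hasType_iff hd).2 hDγ⟩

theorem ncard_componentsIn (hd : d ≠ 0) (L : ℕ) (Z : Set (Fin d → ℤ)) :
    (componentsIn (blackRegion Z) (window L 0)).ncard =
      (clustersIn hd L Z Set.univ).ncard := by
  rw [← Set.ncard_image_of_injective (clustersIn hd L Z Set.univ)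
    (f := fun D : Animal d => openRegion (D.1 : Set (Fin d → ℤ)))
    (openRegion_injective.comp (Finset.coe_injective.comp Subtype.val_injective)),
    componentsIn_blackRegion]
  congr 1
  ext s
  constructor
  · rintro ⟨D, ⟨hD, hDL⟩, rfl⟩
    exact ⟨⟨D, hD.isConnected⟩, ⟨hD, hDL, trivial⟩, rfl⟩
  · rintro ⟨D, ⟨hD, hDL, _⟩, rfl⟩
    exact ⟨D.1, ⟨hD, hDL⟩, rfl⟩

theorem ofReal_clusterCount (C : Shape d) (L : ℕ) (Z : Set (Fin d → ℤ)) :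
    ENNReal.ofReal (clusterCount C.1 L Z) = ∑' x : Fin d → ℤ,
      {x | IsCluster Z (C.1.translate x).1 ∧ (C.1.translate x).1 ⊆ boxSites d L}.indicator 1 x := by
  rw [clusterCount, ENNReal.ofReal_sum_of_nonneg, tsum_eq_sum (s := positions C.1 L)]
  · refine Finset.sum_congr rfl fun x hx => ?_
    rw [mem_positions] at hx
    by_cases h : IsCluster Z (C.1.translate x).1 <;> simp [Set.indicator, h, hx]
  · intro x hx
    rw [mem_positions] at hx
    exact Set.indicator_of_notMem (fun h => hx h.2) _
  · exact fun _ _ => Set.indicator_nonneg (fun _ _ => zero_le_one) _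

theorem translate_mem_clustersIn {hd : d ≠ 0} {L : ℕ} {Z : Set (Fin d → ℤ)}
    {T : Set (HomotopyType d)} {D : Animal d} {x : Fin d → ℤ} :
    D.translate x ∈ clustersIn hd L Z T ↔
      IsCluster Z (D.translate x).1 ∧ (D.translate x).1 ⊆ boxSites d L ∧ D.type hd ∈ T := by
  rw [← D.type_translate hd x]
  rfl

/-- Every cluster in the window is counted at exactly one shape. -/
theorem ncard_clustersIn (hd : d ≠ 0) (L : ℕ) (Z : Set (Fin d → ℤ)) (T : Set (HomotopyType d)) :
    ((clustersIn hd L Z T).ncard : ℝ≥0∞) = ∑' C : Shape d,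
      T.indicator (fun _ => ENNReal.ofReal (clusterCount C.1 L Z)) (C.1.type hd) := by
  have h1 : ((clustersIn hd L Z T).ncard : ℝ≥0∞) =
      ∑' D : Animal d, (clustersIn hd L Z T).indicator 1 D := by
    rw [← tsum_subtype]
    simp only [Pi.one_apply]
    rw [ENNReal.tsum_set_one, ← (finite_clustersIn hd L Z T).cast_ncard_eq]
    simp
  rw [h1, ← (Equiv.ofBijective _ (bijective_translate (d := d))).tsum_eq, ENNReal.tsum_prod']
  refine tsum_congr fun C => ?_
  by_cases hC : C.1.type hd ∈ T
  · rw [Set.indicator_of_mem hC, ofReal_clusterCount]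
    refine tsum_congr fun x => ?_
    have hiff : C.1.translate x ∈ clustersIn hd L Z T ↔
        x ∈ {x | IsCluster Z (C.1.translate x).1 ∧ (C.1.translate x).1 ⊆ boxSites d L} :=
      translate_mem_clustersIn.trans (by simp [hC])
    by_cases hx : C.1.translate x ∈ clustersIn hd L Z T
    · exact (Set.indicator_of_mem hx _).trans (Set.indicator_of_mem (hiff.1 hx)
        (1 : (Fin d → ℤ) → ℝ≥0∞)).symm
    · exact (Set.indicator_of_notMem hx _).trans (Set.indicator_of_notMem (hx ∘ hiff.2)
        (1 : (Fin d → ℤ) → ℝ≥0∞)).symm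
  · rw [Set.indicator_of_notMem hC, ENNReal.tsum_eq_zero]
    intro x
    exact Set.indicator_of_notMem (fun h => hC (translate_mem_clustersIn.1 h).2.2) _

/-- The normalized distribution of the homotopy type of a shape under the weights `a`. -/
noncomputable def typeMeasure (hd : d ≠ 0) (a : Shape d → ℝ) : Measure (HomotopyType d) :=
  (∑' C, ENNReal.ofReal (a C))⁻¹ •
    Measure.sum fun C => ENNReal.ofReal (a C) • Measure.dirac (C.1.type hd)

theorem typeMeasure_apply (hd : d ≠ 0) (a : Shape d → ℝ) (A : Set (HomotopyType d)) :
    typeMeasure hd a A = (∑' C, ENNReal.ofReal (a C))⁻¹ *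
      ∑' C, A.indicator (fun _ => ENNReal.ofReal (a C)) (C.1.type hd) := by
  have hA : MeasurableSet A := trivial
  rw [typeMeasure, Measure.smul_apply, Measure.sum_apply _ hA, smul_eq_mul]
  congr 1
  refine tsum_congr fun C => ?_
  by_cases h : C.1.type hd ∈ A <;> simp [Set.indicator, h]

theorem homotopyMeasure_eq (hd : d ≠ 0) (L : ℕ) (Z : Set (Fin d → ℤ)) :
    homotopyMeasure L Z = typeMeasure hd fun C => clusterCount C.1 L Z := by
  ext A hA
  rw [homotopyMeasure, Measure.sum_apply _ hA, typeMeasure_apply]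
  simp only [ncard_componentsIn_hasType hd, ncard_componentsIn hd, ncard_clustersIn, div_eq_mul_inv,
    Set.indicator_univ, Measure.smul_apply, smul_eq_mul, Measure.dirac_apply' _ hA]
  have h1 : ∀ γ : HomotopyType d, (∑' C : Shape d, ({γ} : Set (HomotopyType d)).indicator
      (fun _ => ENNReal.ofReal (clusterCount C.1 L Z)) (C.1.type hd)) *
        (∑' C : Shape d, ENNReal.ofReal (clusterCount C.1 L Z))⁻¹ * A.indicator 1 γ =
      (∑' C : Shape d, ENNReal.ofReal (clusterCount C.1 L Z))⁻¹ *
        ∑' C : Shape d, ({γ} : Set (HomotopyType d)).indicator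
          (fun _ => ENNReal.ofReal (clusterCount C.1 L Z)) (C.1.type hd) * A.indicator 1 γ := by
    intro γ
    rw [ENNReal.tsum_mul_right]
    ring
  simp only [h1]
  rw [ENNReal.tsum_mul_left, ENNReal.tsum_comm]
  congr 1
  refine tsum_congr fun C => ?_
  rw [tsum_eq_single (C.1.type hd)]
  · by_cases h : C.1.type hd ∈ A <;> simp [Set.indicator, h]
  · intro γ hγ
    rw [Set.indicator_of_notMem (fun h => hγ h.symm), zero_mul]

theorem summable_clusterCount (hd : d ≠ 0) (L : ℕ) (Z : Set (Fin d → ℤ)) :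
    Summable fun C : Shape d => clusterCount C.1 L Z := by
  have h := ncard_clustersIn hd L Z Set.univ
  simp only [Set.indicator_univ] at h
  have h1 := ENNReal.summable_toReal (h ▸ ENNReal.natCast_ne_top _)
  simpa only [ENNReal.toReal_ofReal (clusterCount_nonneg _ L Z)] using h1

theorem typeMeasure_real (hd : d ≠ 0) {a : Shape d → ℝ} (h0 : ∀ C, 0 ≤ a C) (ha : Summable a)
    (A : Set (HomotopyType d)) :
    (typeMeasure hd a).real A =
      (∑' C, A.indicator (fun _ => a C) (C.1.type hd)) / ∑' C, a C := by
  have h1 : ∀ C : Shape d, A.indicator (fun _ => ENNReal.ofReal (a C)) (C.1.type hd) =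
      ENNReal.ofReal (A.indicator (fun _ => a C) (C.1.type hd)) := fun C => by
    by_cases h : C.1.type hd ∈ A <;> simp [Set.indicator, h]
  have h2 : ∀ C : Shape d, 0 ≤ A.indicator (fun _ => a C) (C.1.type hd) := fun C =>
    Set.indicator_nonneg (fun _ _ => h0 C) _
  have h3 : Summable fun C : Shape d => A.indicator (fun _ => a C) (C.1.type hd) :=
    ha.of_nonneg_of_le h2 fun C => Set.indicator_le_self' (fun _ _ => h0 C) _
  rw [measureReal_def, typeMeasure_apply]
  simp only [h1]
  rw [← ENNReal.ofReal_tsum_of_nonneg h0 ha, ← ENNReal.ofReal_tsum_of_nonneg h2 h3,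
    ENNReal.toReal_mul, ENNReal.toReal_inv, ENNReal.toReal_ofReal (tsum_nonneg h0),
    ENNReal.toReal_ofReal (tsum_nonneg h2), div_eq_inv_mul]

/-! ### Convergence in total variation -/

theorem abs_div_sub_div_le {x n l t g : ℝ} (ht : 0 < t) (hx : 0 ≤ x) (hxn : x ≤ n) (hl : 0 ≤ l)
    (hlt : l ≤ t) (h1 : |x - l| ≤ g) (h2 : |n - t| ≤ g) : |x / n - l / t| ≤ 2 * g / t := by
  rcases (hx.trans hxn).eq_or_lt with hn | hn
  · -- here `x / n = 0`, and the bound holds because `g` is at least `t`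
    rw [← hn, div_zero, zero_sub, abs_neg, abs_of_nonneg (div_nonneg hl ht.le)]
    rw [← hn, zero_sub, abs_neg, abs_of_pos ht] at h2
    exact div_le_div_of_nonneg_right (by linarith) ht.le
  · have h3 : x / n - l / t = ((x - l) + x / n * (t - n)) / t := by
      field_simp
      ring
    rw [h3, abs_div, abs_of_pos ht]
    refine div_le_div_of_nonneg_right ((abs_add_le _ _).trans ?_) ht.le
    rw [abs_mul, abs_of_nonneg (div_nonneg hx hn.le), abs_sub_comm t n]
    have h4 : x / n * |n - t| ≤ 1 * |n - t| :=
      mul_le_mul_of_nonneg_right (div_le_one_of_le₀ hxn hn.le) (abs_nonneg _)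
    linarith

/-- The total variation distance of two normalized distributions is bounded by the `ℓ¹` distance of
their weights, where one of the weights may be rescaled. -/
theorem tvDist_typeMeasure_le (hd : d ≠ 0) {a b : Shape d → ℝ} (ha0 : ∀ C, 0 ≤ a C)
    (ha : Summable a) (hb0 : ∀ C, 0 ≤ b C) (hb : Summable b) (hb1 : 0 < ∑' C, b C) {v : ℝ}
    (hv : 0 < v) :
    tvDist (typeMeasure hd a) (typeMeasure hd b) ≤ 2 * (∑' C, |a C / v - b C|) / ∑' C, b C := by
  have : Nonempty {A : Set (HomotopyType d) // MeasurableSet A} := ⟨⟨∅, MeasurableSet.empty⟩⟩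
  refine ciSup_le fun A => ?_
  have hs : ∀ {c : Shape d → ℝ}, (∀ C, 0 ≤ c C) → Summable c →
      Summable fun C : Shape d => A.1.indicator (fun _ => c C) (C.1.type hd) := fun h0 hc =>
    hc.of_nonneg_of_le (fun C => Set.indicator_nonneg (fun _ _ => h0 C) _)
      fun C => Set.indicator_le_self' (fun _ _ => h0 C) _
  have hle : ∀ {c : Shape d → ℝ}, (∀ C, 0 ≤ c C) → Summable c →
      ∑' C : Shape d, A.1.indicator (fun _ => c C) (C.1.type hd) ≤ ∑' C, c C := fun h0 hc =>
    (hs h0 hc).tsum_le_tsum (fun C => Set.indicator_le_self' (fun _ _ => h0 C) _) hc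
  have hnn : ∀ {c : Shape d → ℝ}, (∀ C, 0 ≤ c C) →
      0 ≤ ∑' C : Shape d, A.1.indicator (fun _ => c C) (C.1.type hd) := fun h0 =>
    tsum_nonneg fun C => Set.indicator_nonneg (fun _ _ => h0 C) _
  have hg : Summable fun C => |a C / v - b C| := ((ha.div_const v).sub hb).abs
  have h1 : |(∑' C : Shape d, A.1.indicator (fun _ => a C) (C.1.type hd)) / v -
      ∑' C : Shape d, A.1.indicator (fun _ => b C) (C.1.type hd)| ≤ ∑' C, |a C / v - b C| := by
    rw [← tsum_div_const, ← ((hs ha0 ha).div_const v).tsum_sub (hs hb0 hb), ← Real.norm_eq_abs]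
    refine tsum_of_norm_bounded hg.hasSum fun C => ?_
    by_cases h : C.1.type hd ∈ A.1 <;> simp [Set.indicator, h]
  have h2 : |(∑' C, a C) / v - ∑' C, b C| ≤ ∑' C, |a C / v - b C| := by
    rw [← tsum_div_const, ← (ha.div_const v).tsum_sub hb, ← Real.norm_eq_abs]
    exact tsum_of_norm_bounded hg.hasSum fun C => (Real.norm_eq_abs _).le
  have h3 := abs_div_sub_div_le hb1 (div_nonneg (hnn ha0) hv.le)
    (div_le_div_of_nonneg_right (hle ha0 ha) hv.le) (hnn hb0) (hle hb0 hb) h1 h2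
  rwa [div_div_div_cancel_right₀ hv.ne', ← typeMeasure_real hd ha0 ha,
    ← typeMeasure_real hd hb0 hb] at h3

/-- The single cube is a shape. -/
instance : Nonempty (Shape d) := by
  have h : IsConnected (openRegion (({0} : Finset (Fin d → ℤ)) : Set (Fin d → ℤ))) := by
    refine ⟨⟨cubeCenter 0, cubeCenter_mem_openRegion.2 (by simp)⟩,
      isPreconnected_of_forall (cubeCenter 0) fun x hx => ?_⟩
    have h0 : x ∈ unitCube (0 : Fin d → ℤ) := by
      have h1 := hx _ (mem_unitCube_floor x)
      rw [Finset.coe_singleton, Set.mem_singleton_iff] at h1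
      exact h1 ▸ mem_unitCube_floor x
    exact ⟨segment ℝ x (cubeCenter 0), segment_subset_openRegion hx h0, right_mem_segment ℝ _ _,
      left_mem_segment ℝ _ _, (convex_segment _ _).isPreconnected⟩
  exact ⟨⟨⟨{0}, h⟩, by simp, by simp⟩⟩

theorem tsum_density_pos {q : unitInterval} (h0 : 0 < q) (h1 : q < 1) :
    0 < ∑' C : Shape d, density q C.1 :=
  (summable_density q).tsum_pos (fun C => density_nonneg q C.1) (Classical.arbitrary _)
    (density_pos h0 h1 _)

/-- Convergence in probability, by Markov's inequality for the `ℓ¹` distance between the cluster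
counts per site and the densities. -/
theorem IsBernoulliPercolation.tendsto_tvDist (hd : d ≠ 0) {Ω : Type*} [MeasurableSpace Ω]
    {P : Measure Ω} [IsProbabilityMeasure P] {Z : Ω → Set (Fin d → ℤ)} {q : unitInterval}
    (h : IsBernoulliPercolation P q Z) (hpos : 0 < ∑' C : Shape d, density q C.1) {ε : ℝ}
    (hε : 0 < ε) :
    Tendsto (fun L : ℕ => P {ω | ε < tvDist (homotopyMeasure L (Z ω))
      (typeMeasure hd fun C => density q C.1)}) atTop (𝓝 0) := by
  let c : ℝ≥0∞ := ENNReal.ofReal (ε * (∑' C : Shape d, density q C.1) / 2)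
  have hc0 : c ≠ 0 := (ENNReal.ofReal_pos.2 (by positivity)).ne'
  let G : ℕ → Ω → ℝ≥0∞ := fun L ω =>
    ∑' C : Shape d, ENNReal.ofReal |clusterCount C.1 L (Z ω) / (L : ℝ) ^ d - density q C.1|
  have hint : ∀ L (C : Shape d), Integrable
      (fun ω => |clusterCount C.1 L (Z ω) / (L : ℝ) ^ d - density q C.1|) P := fun L C =>
    ((h.integrable_clusterCount_div C.1 L).sub (integrable_const _)).abs
  have hmeas : ∀ L (C : Shape d), AEMeasurable (fun ω =>
      ENNReal.ofReal |clusterCount C.1 L (Z ω) / (L : ℝ) ^ d - density q C.1|) P := fun L C =>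
    (hint L C).aemeasurable.ennreal_ofReal
  have hG : ∀ L, ∫⁻ ω, G L ω ∂P = ENNReal.ofReal (∑' C : Shape d, deviation P Z q C.1 L) := by
    intro L
    have hdev0 : ∀ C : Shape d, 0 ≤ deviation P Z q C.1 L := fun C => deviation_nonneg C.1 L
    have hdev : Summable fun C : Shape d => deviation P Z q C.1 L :=
      ((summable_density q).mul_left 2).of_nonneg_of_le hdev0 fun C => h.deviation_le C.1 L
    rw [lintegral_tsum (hmeas L), ENNReal.ofReal_tsum_of_nonneg hdev0 hdev]
    refine tsum_congr fun C => ?_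
    rw [deviation, ofReal_integral_eq_lintegral_ofReal (hint L C)
      (Eventually.of_forall fun _ => abs_nonneg _)]
  have hbound : ∀ L : ℕ, L ≠ 0 → P {ω | ε < tvDist (homotopyMeasure L (Z ω))
      (typeMeasure hd fun C => density q C.1)} ≤
        ENNReal.ofReal (∑' C : Shape d, deviation P Z q C.1 L) / c := by
    intro L hL
    rw [← hG L]
    refine (measure_mono fun ω hω => ?_).trans
      (meas_ge_le_lintegral_div (AEMeasurable.tsum (hmeas L)) hc0 ENNReal.ofReal_ne_top)
    have hs := summable_clusterCount hd L (Z ω)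
    have h1 : ε < tvDist (homotopyMeasure L (Z ω)) (typeMeasure hd fun C => density q C.1) := hω
    rw [homotopyMeasure_eq hd] at h1
    have h2 := h1.trans_le (tvDist_typeMeasure_le hd (a := fun C => clusterCount C.1 L (Z ω))
      (b := fun C => density q C.1) (fun C => clusterCount_nonneg C.1 L (Z ω)) hs
      (fun C => density_nonneg q C.1) (summable_density q) hpos
      (v := (L : ℝ) ^ d) (by positivity))
    rw [lt_div_iff₀ hpos] at h2
    change c ≤ G L ω
    simp only [G]
    rw [← ENNReal.ofReal_tsum_of_nonneg (fun _ => abs_nonneg _)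
      ((hs.div_const _).sub (summable_density q)).abs]
    exact ENNReal.ofReal_le_ofReal (by linarith)
  have hlim : Tendsto (fun L : ℕ => ENNReal.ofReal (∑' C : Shape d, deviation P Z q C.1 L) / c)
      atTop (𝓝 0) := by
    have h1 := ENNReal.tendsto_ofReal (h.tendsto_tsum_deviation hd)
    have h2 := ENNReal.Tendsto.div_const h1 (Or.inr hc0)
    simpa using h2
  refine tendsto_of_tendsto_of_tendsto_of_le_of_le' tendsto_const_nhds hlim
    (Eventually.of_forall fun _ => bot_le) ?_
  filter_upwards [eventually_ne_atTop 0] with L hL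
  exact hbound L hL

theorem isProbabilityMeasure_typeMeasure (hd : d ≠ 0) {q : unitInterval} (h0 : 0 < q)
    (h1 : q < 1) : IsProbabilityMeasure (typeMeasure hd fun C => density q C.1) := by
  refine ⟨?_⟩
  rw [typeMeasure_apply]
  simp only [Set.indicator_univ]
  rw [← ENNReal.ofReal_tsum_of_nonneg (f := fun C : Shape d => density q C.1)
    (fun C => density_nonneg q C.1) (summable_density q)]
  exact ENNReal.inv_mul_cancel (ENNReal.ofReal_pos.2 (tsum_density_pos h0 h1)).ne'
    ENNReal.ofReal_ne_top

theorem typeMeasure_singleton_pos (hd : d ≠ 0) {q : unitInterval} (h0 : 0 < q) (h1 : q < 1)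
    (γ : HomotopyType d) : 0 < typeMeasure hd (fun C => density q C.1) {γ} := by
  obtain ⟨C, hC⟩ := exists_shape_type hd γ
  rw [typeMeasure_apply, ← ENNReal.ofReal_tsum_of_nonneg (f := fun C : Shape d => density q C.1)
    (fun C => density_nonneg q C.1) (summable_density q)]
  refine ENNReal.mul_pos (ENNReal.inv_ne_zero.2 ENNReal.ofReal_ne_top) fun h => ?_
  have h2 := ENNReal.tsum_eq_zero.1 h C
  rw [Set.indicator_of_mem (by simpa using hC)] at h2
  exact (ENNReal.ofReal_pos.2 (density_pos h0 h1 C.1)).ne' h2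

end CubicalPercolation

theorem theorem1p2 (d : ℕ) (hd : 2 ≤ d) (p : ℝ) (hp0 : 0 < p) (hp1 : p < 1) :
    ∃ μ : MeasureTheory.Measure (CubicalPercolation.HomotopyType d),
      MeasureTheory.IsProbabilityMeasure μ ∧
      (∀ γ : CubicalPercolation.HomotopyType d, 0 < μ {γ}) ∧
      ∀ (Ω : Type*) [MeasurableSpace Ω] (P : MeasureTheory.Measure Ω)
        [MeasureTheory.IsProbabilityMeasure P] (Z : Ω → Set (Fin d → ℤ)),
        CubicalPercolation.IsBernoulliPercolation P p Z →
        ∀ ε : ℝ, 0 < ε →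
          Filter.Tendsto
            (fun L : ℕ => P {ω | ε <
              CubicalPercolation.tvDist (CubicalPercolation.homotopyMeasure L (Z ω)) μ})
            Filter.atTop (nhds 0) := by
  have hd0 : d ≠ 0 := by omega
  let q : unitInterval := ⟨p, hp0.le, hp1.le⟩
  have h0 : 0 < q := hp0
  have h1 : q < 1 := hp1
  refine ⟨CubicalPercolation.typeMeasure hd0 fun C => CubicalPercolation.density q C.1,
    CubicalPercolation.isProbabilityMeasure_typeMeasure hd0 h0 h1,
    CubicalPercolation.typeMeasure_singleton_pos hd0 h0 h1, ?_⟩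
  intro Ω _ P _ Z hZ ε hε
  exact CubicalPercolation.IsBernoulliPercolation.tendsto_tvDist hd0 (q := q) hZ
    (CubicalPercolation.tsum_density_pos h0 h1) hε
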